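/- Let $1\le d\le n$, and let $I(d,n)$ be the set of sequences $\mathbf I=[i_1<\dots<i_d]$ in $\{1,\dots,n\}$, partially ordered by $\mathbf I\le\mathbf J$ iff $i_k\le j_k$ for all $k$. Let $\mathrm{Gr}_{d,n}\subset\mathbb P(\Lambda^d\mathbb C^n)$ be the Grassmannian of $d$-dimensional subspaces of $\mathbb C^n$ in its Plücker embedding, with Plücker coordinates $p_{\mathbf I}$, $\mathbf I\in I(d,n)$, and let $I_{d,n}\subset\mathbb C[p_{\mathbf I}\mid\mathbf I\in I(d,n)]$ be its homogeneous vanishing ideal. Then there is a flat degeneration of $\mathrm{Gr}_{d,n}$ into a union of toric varieties, namely of projective spaces. Precisely, there is a homogeneous ideal $\mathcal J\subset\mathbb C[t][p_{\mathbf I}\mid \mathbf I\in I(d,n)]$ such that the closed subscheme $\mathfrak X=\mathrm{Proj}\,(\mathbb C[t][p_{\mathbf I}]/\mathcal J)$ of $\mathbb P(\Lambda^d\mathbb C^n)\times\mathbb A^1$ has the following properties. 1. The projection $\mathfrak X\to\mathbb A^1=\mathrm{Spec}\,\mathbb C[t]$ is flat. 2. Putting $t=1$ in $\mathcal J$ gives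 $I_{d,n}$, and for every $c\in\mathbb C$, $c\neq0$, the fibre of $\mathfrak X$ over $t=c$ is isomorphic to $\mathrm{Gr}_{d,n}$ over $\mathbb C$. 3. Putting $t=0$ in $\mathcal J$ gives the ideal $I_0$ generated by the monomials $p_{\mathbf I}p_{\mathbf J}$ for all non-comparable pairs $\mathbf I,\mathbf J\in I(d,n)$, and the fibre of $\mathfrak X$ over $t=0$ (the initial scheme) is isomorphic over $\mathbb C$ to $X_0=\mathrm{Proj}\,(\mathbb C[p_{\mathbf I}]/I_0)$. 4. $X_0$ is a reduced union of projective spaces, one for each maximal chain of $I(d,n)$: it is reduced, and for every maximal chain $\mathcal C$ there is a closed immersion over $\mathbb C$ of $\mathbb P^{d(n-d)}_{\mathbb C}$ into $X_0$ whose image is the locus $\{p_{\mathbf I}=0 \text{ for all } \mathbf I\notin\mathcal C\}$; these images are pairwise distinct for distinct maximal chains, and they are exactly the irreducible components of $X_0$. -/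

import Mathlib

open CategoryTheory AlgebraicGeometry DirectSum

attribute [local instance] MvPolynomial.gradedAlgebra

noncomputable section

/-! ### The poset `I(d,n)` -/

/-- `I(d,n)`: the strictly increasing sequences `i_1 < ... < i_d` in an `n`-element chain
(written `0, ..., n-1`). As a subtype of `Fin d → Fin n` it carries the componentwise order. -/
abbrev GrIndex (d n : ℕ) : Type := {I : Fin d → Fin n // StrictMono I}

/-! ### Projective schemes attached to graded algebras and homogeneous ideals -/

section Quotient

variable {R S : Type} [CommRing R] [CommRing S] [Algebra R S]
  {𝒜 : ℕ → Submodule R S} [GradedAlgebra 𝒜]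

/-- The grading on the quotient `S ⧸ J` by a homogeneous ideal: the degree `i` part is the image
of the degree `i` part of `S`. -/
def quotGrading (J : HomogeneousIdeal 𝒜) (i : ℕ) : Submodule R (S ⧸ J.toIdeal) :=
  (𝒜 i).map (Ideal.Quotient.mkₐ R J.toIdeal).toLinearMap

theorem mk_mem_quotGrading (J : HomogeneousIdeal 𝒜) {i : ℕ} {x : S} (hx : x ∈ 𝒜 i) :
    Ideal.Quotient.mk J.toIdeal x ∈ quotGrading J i :=
  ⟨x, hx, rfl⟩

instance quotGrading.gradedMonoid (J : HomogeneousIdeal 𝒜) :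
    SetLike.GradedMonoid (quotGrading J) where
  one_mem := mk_mem_quotGrading J (SetLike.one_mem_graded 𝒜)
  mul_mem := by
    rintro i j _ _ ⟨x, hx, rfl⟩ ⟨y, hy, rfl⟩
    exact mk_mem_quotGrading J (SetLike.mul_mem_graded hx hy)

/-- The map sending `x` to the classes of its homogeneous components. -/
def quotDecomposeAux (J : HomogeneousIdeal 𝒜) : S →+ ⨁ i, quotGrading J i :=
  (DirectSum.map fun i =>
    ({ toFun := fun x => ⟨Ideal.Quotient.mk J.toIdeal x, mk_mem_quotGrading J x.2⟩
       map_zero' := by ext; simp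
       map_add' := by intro x y; ext; simp } : 𝒜 i →+ quotGrading J i)).comp
    (DirectSum.decomposeAddEquiv 𝒜).toAddMonoidHom

theorem quotDecomposeAux_apply (J : HomogeneousIdeal 𝒜) (x : S) (i : ℕ) :
    ((quotDecomposeAux J x i : quotGrading J i) : S ⧸ J.toIdeal) =
      Ideal.Quotient.mk J.toIdeal (DirectSum.decompose 𝒜 x i : S) := by
  simp [quotDecomposeAux, DirectSum.map_apply]

/-- The decomposition of `S ⧸ J` into homogeneous components. -/
def quotDecompose (J : HomogeneousIdeal 𝒜) : S ⧸ J.toIdeal →+ ⨁ i, quotGrading J i :=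
  QuotientAddGroup.lift (Submodule.toAddSubgroup J.toIdeal) (quotDecomposeAux J) (by
    intro x hx
    refine DFinsupp.ext fun i => Subtype.ext ?_
    rw [quotDecomposeAux_apply]
    exact Ideal.Quotient.eq_zero_iff_mem.2 (J.isHomogeneous i hx))

theorem quotDecompose_mk (J : HomogeneousIdeal 𝒜) (x : S) :
    quotDecompose J (Ideal.Quotient.mk J.toIdeal x) = quotDecomposeAux J x := rfl

instance quotGrading.gradedAlgebra (J : HomogeneousIdeal 𝒜) : GradedAlgebra (quotGrading J) where
  toGradedMonoid := inferInstance
  toDecomposition := Decomposition.ofAddHom _ (quotDecompose J)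
    (by
      ext y
      obtain ⟨x, rfl⟩ := Ideal.Quotient.mk_surjective y
      simp only [AddMonoidHom.comp_apply, AddMonoidHom.id_apply, quotDecompose_mk]
      induction x using DirectSum.Decomposition.inductionOn 𝒜 with
      | zero => simp
      | homogeneous m => simp [quotDecomposeAux]
      | add a b ha hb => simp only [map_add, ha, hb])
    (by
      ext i ⟨_, x, hx, rfl⟩ : 2
      simp only [AddMonoidHom.comp_apply, AddMonoidHom.id_apply, coeAddMonoidHom_of]
      change quotDecomposeAux J x = _
      simp [quotDecomposeAux, DirectSum.decompose_of_mem 𝒜 hx])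

end Quotient

/-- The structure morphism `Proj S ⟶ Spec R` of a graded `R`-algebra `S`. -/
def projStr {R S : Type} [CommRing R] [CommRing S] [Algebra R S]
    (𝒜 : ℕ → Submodule R S) [GradedAlgebra 𝒜] : Proj 𝒜 ⟶ Spec (CommRingCat.of R) :=
  Proj.toSpecZero 𝒜 ≫ Spec.map (CommRingCat.ofHom (algebraMap R (𝒜 0)))

/-- Homogeneous ideals of the polynomial ring `R[x_s | s ∈ σ]`. -/
abbrev HomIdeal (σ R : Type) [CommRing R] : Type :=
  HomogeneousIdeal (MvPolynomial.homogeneousSubmodule σ R)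

/-- The closed subscheme of the projective space over `R` with homogeneous coordinates
`x_s`, `s ∈ σ`, defined by the homogeneous ideal `J`, namely `Proj (R[x_s | s ∈ σ] ⧸ J)`. -/
def projScheme {σ R : Type} [CommRing R] (J : HomIdeal σ R) : Scheme :=
  Proj (quotGrading J)

/-- The structure morphism to `Spec R` of the projective scheme defined by `J`. -/
def projSchemeStr {σ R : Type} [CommRing R] (J : HomIdeal σ R) :
    projScheme J ⟶ Spec (CommRingCat.of R) :=
  projStr (quotGrading J)

/-- The projective scheme defined by `J`, as a scheme over `Spec R`. -/
def projSchemeOver {σ R : Type} [CommRing R] (J : HomIdeal σ R) :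
    Over (Spec (CommRingCat.of R)) :=
  Over.mk (projSchemeStr J)

/-- The locus in the projective scheme defined by `J` where all `f ∈ T` vanish. -/
def projZeroLocus {σ R : Type} [CommRing R] (J : HomIdeal σ R) (T : Set (MvPolynomial σ R)) :
    Set (projScheme J) :=
  ProjectiveSpectrum.zeroLocus (quotGrading J) (Ideal.Quotient.mk J.toIdeal '' T)

/-- Complex projective space of dimension `N`. -/
def cProjSpace (N : ℕ) : Scheme := Proj (MvPolynomial.homogeneousSubmodule (Fin (N + 1)) ℂ)

/-- Complex projective space as a scheme over `Spec ℂ`. -/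
def cProjSpaceOver (N : ℕ) : Over (Spec (CommRingCat.of ℂ)) :=
  Over.mk (Y := cProjSpace N) (projStr (MvPolynomial.homogeneousSubmodule (Fin (N + 1)) ℂ))

/-! ### One-parameter families of projective schemes -/

/-- The fibre over the point `t = c` of the affine line `Spec ℂ[t]` of the family
`projScheme J ⟶ Spec ℂ[t]`, as a scheme over `Spec ℂ`. -/
def familyFibre {σ : Type} (J : HomIdeal σ (Polynomial ℂ)) (c : ℂ) :
    Over (Spec (CommRingCat.of ℂ)) :=
  Over.mk (Limits.pullback.snd (projSchemeStr J)
    (Spec.map (CommRingCat.ofHom (Polynomial.evalRingHom c))))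

/-- The ideal of `ℂ[x_s | s ∈ σ]` obtained from `J` by putting `t = c`. -/
def specializeIdeal {σ : Type} (J : HomIdeal σ (Polynomial ℂ)) (c : ℂ) :
    Ideal (MvPolynomial σ ℂ) :=
  J.toIdeal.map (MvPolynomial.map (Polynomial.evalRingHom c))

/-! ### The Grassmannian and the monomial ideal -/

/-- The vectors of Plücker coordinates of `d`-dimensional subspaces of `ℂⁿ`: for a basis
`b_1, ..., b_d` of a subspace `W`, the coordinate `p_I` of `b_1 ∧ ... ∧ b_d` with respect to
`e_{i_1} ∧ ... ∧ e_{i_d}` is the minor on the columns `i_1 < ... < i_d`. -/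
def pluckerVectors (d n : ℕ) : Set (GrIndex d n → ℂ) :=
  {x | ∃ (W : Submodule ℂ (Fin n → ℂ)) (b : Module.Basis (Fin d) ℂ W),
    x = fun I => (Matrix.of fun a k => (b a : Fin n → ℂ) (I.1 k)).det}

/-- The homogeneous ideal of the Grassmannian `Gr_{d,n}` in its Plücker embedding: it is generated
by the homogeneous polynomials in the Plücker coordinates that vanish on `Gr_{d,n}`. -/
def pluckerIdeal (d n : ℕ) : HomIdeal (GrIndex d n) ℂ :=
  Ideal.homogeneousCore _ (MvPolynomial.vanishingIdeal ℂ (pluckerVectors d n))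

/-- The Grassmannian `Gr_{d,n}` over `ℂ`, as a projective scheme in its Plücker embedding. -/
def grassmannianOver (d n : ℕ) : Over (Spec (CommRingCat.of ℂ)) :=
  projSchemeOver (pluckerIdeal d n)

/-- The ideal generated by the monomials `p_I p_J` for non-comparable `I`, `J` in `I(d,n)`. -/
def incompIdeal (d n : ℕ) : HomIdeal (GrIndex d n) ℂ :=
  ⟨Ideal.span {f | ∃ I J : GrIndex d n, ¬ I ≤ J ∧ ¬ J ≤ I ∧
      f = MvPolynomial.X I * MvPolynomial.X J},
    Ideal.homogeneous_span _ _ (by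
      rintro _ ⟨I, J, -, -, rfl⟩
      exact ⟨2, (MvPolynomial.isHomogeneous_X ℂ I).mul (MvPolynomial.isHomogeneous_X ℂ J)⟩)⟩

end

/-! The family rescales the coordinate p_I by t^h(I), with h(I) = (dn)² - w(I)² and w(I) the sum of
the entries of I. Its ideal (`familyIdeal`) consists of the polynomials over ℂ[t] whose homogeneous
components all vanish on the rescaled Plücker vectors. The values lie in a torsion-free ℂ[t]-module,
so the quotient is torsion-free, and over a Dedekind base this gives flatness on every chart
(`flat_projStr`). At t = c ≠ 0 the rescaling is invertible, so the fibre is the Grassmannian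
(`map_familyIdeal`, `nonempty_familyFibre_iso`).

The fibre at t = 0 rests on two facts of standard monomial theory. Straightening
(`Matrix.maximalMinor_mul_mem_span`): for incomparable I, J, an exchange of d + 1 columns expresses
p_I p_J through products p_K p_L with w(K)² + w(L)² larger, that is, with smaller total height. In
the family these terms acquire a positive power of t, and p_I p_J alone survives at t = 0.
Independence (`eq_zero_of_aeval_pluckerVectors`): the lex leading term of a minor is its diagonal
product, and monomials supported on chains are determined by their leading exponents
(`leadExp_injOn`). So the standard monomials are a ℂ[t]-basis of the quotient, and nothing else can
enter the ideal at t = 0 (`specializeIdeal_familyIdeal_zero`).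

The monomial ideal is the intersection of the ideals of coordinate subspaces, one for each maximal
chain (`mem_incompIdeal_of_forall_flag`); hence the special fibre is reduced. The poset is graded by
w, so every maximal chain has d(n - d) + 1 members (`GrIndex.ncard_flag`) and every subspace has
dimension d(n - d). -/

/-! ### Surjective homomorphisms of graded rings and their chart rings -/

section GradedRings

variable {A B : Type} [CommRing A] [CommRing B] {σ τ : Type} [SetLike σ A] [AddSubgroupClass σ A]
  [SetLike τ B] [AddSubgroupClass τ B] {𝒜 : ℕ → σ} {ℬ : ℕ → τ} [GradedRing 𝒜] [GradedRing ℬ]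

theorem GradedRingHom.exists_mem_map_eq (f : 𝒜 →+*ᵍ ℬ) (hf : Function.Surjective f) {i : ℕ} {b : B}
    (hb : b ∈ ℬ i) : ∃ a ∈ 𝒜 i, f a = b := by
  obtain ⟨a, rfl⟩ := hf b
  exact ⟨decompose 𝒜 a i, SetLike.coe_mem _, by
    rw [f.map_directSumDecompose, decompose_of_mem_same _ hb]⟩

theorem GradedRingHom.irrelevant_le_map (f : 𝒜 →+*ᵍ ℬ) (hf : Function.Surjective f) :
    HomogeneousIdeal.irrelevant ℬ ≤ (HomogeneousIdeal.irrelevant 𝒜).map f := by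
  rw [HomogeneousIdeal.irrelevant_le]
  intro i hi b hb
  obtain ⟨a, ha, rfl⟩ := f.exists_mem_map_eq hf hb
  exact Ideal.mem_map_of_mem f (HomogeneousIdeal.mem_irrelevant_of_mem _ hi ha)

theorem HomogeneousLocalization.Away.map_surjective (f : 𝒜 →+*ᵍ ℬ) (hf : Function.Surjective f)
    {s : A} {i : ℕ} (hs : s ∈ 𝒜 i) :
    Function.Surjective (HomogeneousLocalization.Away.map f s) := by
  intro x
  obtain ⟨n, b, hb, rfl⟩ := x.mk_surjective _ (f.map_mem hs)
  obtain ⟨a, ha, rfl⟩ := f.exists_mem_map_eq hf hb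
  exact ⟨HomogeneousLocalization.Away.mk 𝒜 hs n a ha,
    HomogeneousLocalization.Away.map_mk f s hs n a ha⟩

theorem HomogeneousLocalization.Away.mk_eq_zero_iff {s : A} {i : ℕ} (hs : s ∈ 𝒜 i) {n : ℕ} {a : A}
    (ha : a ∈ 𝒜 (n • i)) :
    HomogeneousLocalization.Away.mk 𝒜 hs n a ha = 0 ↔ ∃ k : ℕ, s ^ k * a = 0 := by
  rw [HomogeneousLocalization.ext_iff_val, HomogeneousLocalization.Away.val_mk,
    HomogeneousLocalization.val_zero, Localization.mk_eq_mk', IsLocalization.mk'_eq_zero_iff]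
  constructor
  · rintro ⟨⟨_, k, rfl⟩, h⟩
    exact ⟨k, h⟩
  · rintro ⟨k, h⟩
    exact ⟨⟨_, k, rfl⟩, h⟩

end GradedRings

/-! ### Base change of rings along a surjection -/

section Pushout

variable {R R' A B : Type} [CommRing R] [CommRing R'] [CommRing A] [CommRing B]

/-- The hypotheses identify B with A/(ker φ)A, which is the base change of A along R → R'. A map out
of A that is compatible with one out of R' kills (ker φ)A, hence descends along g. -/
theorem CommRingCat.isPushout_of_surjective (φ : R →+* R') (f : R →+* A) (g : A →+* B)
    (h : R' →+* B) (hcomm : g.comp f = h.comp φ) (hφ : Function.Surjective φ)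
    (hg : Function.Surjective g) (hker : RingHom.ker g ≤ (RingHom.ker φ).map f) :
    IsPushout (CommRingCat.ofHom f) (CommRingCat.ofHom φ) (CommRingCat.ofHom g)
      (CommRingCat.ofHom h) := by
  have w : CommRingCat.ofHom f ≫ CommRingCat.ofHom g =
      CommRingCat.ofHom φ ≫ CommRingCat.ofHom h := by
    rw [← CommRingCat.ofHom_comp, ← CommRingCat.ofHom_comp, hcomm]
  have hle (s : Limits.PushoutCocone (CommRingCat.ofHom f) (CommRingCat.ofHom φ)) :
      RingHom.ker g ≤ RingHom.ker s.inl.hom := by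
    refine hker.trans (Ideal.map_le_iff_le_comap.2 fun r hr => ?_)
    have := congr($(s.condition).hom r)
    simp only [CommRingCat.hom_comp, CommRingCat.hom_ofHom, RingHom.comp_apply] at this
    rw [RingHom.mem_ker] at hr
    rw [Ideal.mem_comap, RingHom.mem_ker, this, hr, map_zero]
  have hd (s : Limits.PushoutCocone (CommRingCat.ofHom f) (CommRingCat.ofHom φ)) (a : A) :
      g.liftOfSurjective hg ⟨s.inl.hom, hle s⟩ (g a) = s.inl.hom a :=
    RingHom.liftOfRightInverse_comp_apply g _ _ ⟨s.inl.hom, hle s⟩ a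
  refine ⟨⟨w⟩, ⟨Limits.PushoutCocone.IsColimit.mk w
    (fun s => CommRingCat.ofHom (g.liftOfSurjective hg ⟨s.inl.hom, hle s⟩)) ?_ ?_ ?_⟩⟩
  · intro s
    ext a
    exact hd s a
  · intro s
    ext r'
    obtain ⟨r, rfl⟩ := hφ r'
    have h1 : h (φ r) = g (f r) := congr($hcomm.symm r)
    change g.liftOfSurjective hg _ (h (φ r)) = _
    rw [h1, hd]
    exact congr($(s.condition).hom r)
  · intro s m hm _
    ext b
    obtain ⟨a, rfl⟩ := hg b
    exact congr($(hm).hom a).trans (hd s a).symm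

end Pushout

/-! ### Morphisms of Proj, checked on charts -/

section Proj

variable {R A : Type} [CommRing R] [CommRing A] [Algebra R A] {𝒜 : ℕ → Submodule R A}
  [GradedAlgebra 𝒜]

/-- The structure map from the base ring to the chart ring of `Proj` attached to `s`. -/
noncomputable def awayStr (𝒜 : ℕ → Submodule R A) [GradedAlgebra 𝒜] (s : A) :
    R →+* HomogeneousLocalization.Away 𝒜 s :=
  (HomogeneousLocalization.fromZeroRingHom 𝒜 _).comp (algebraMap R (𝒜 0))

theorem awayι_projStr {s : A} {i : ℕ} (hs : s ∈ 𝒜 i) (hi : 0 < i) :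
    Proj.awayι 𝒜 s hs hi ≫ projStr 𝒜 = Spec.map (CommRingCat.ofHom (awayStr 𝒜 s)) := by
  rw [projStr, Proj.awayι_toSpecZero_assoc, ← Spec.map_comp, ← CommRingCat.ofHom_comp, awayStr]

theorem awayι_projStr_assoc {s : A} {i : ℕ} (hs : s ∈ 𝒜 i) (hi : 0 < i) {Z : Scheme}
    (h : Spec (CommRingCat.of R) ⟶ Z) :
    Proj.awayι 𝒜 s hs hi ≫ projStr 𝒜 ≫ h =
      Spec.map (CommRingCat.ofHom (awayStr 𝒜 s)) ≫ h := by
  rw [← Category.assoc, awayι_projStr]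

theorem val_awayStr (s : A) (r : R) :
    (awayStr 𝒜 s r).val = algebraMap A _ (algebraMap R A r) := by
  rw [← Localization.mk_one_eq_algebraMap]
  rfl

/-- Flatness is local on the source, and over a Dedekind domain it amounts to torsion-freeness. A
torsion relation in a chart ring becomes one in A after multiplication by a power of s. -/
theorem flat_projStr [IsDedekindDomain R]
    (h : ∀ (r : R) (a : A), r ≠ 0 → algebraMap R A r * a = 0 → a = 0) : Flat (projStr 𝒜) := by
  have : IsZariskiLocalAtSource @Flat.{0} :=
    HasRingHomProperty.instIsZariskiLocalAtSource (Q := RingHom.Flat)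
  have hflat {s : A} {i : ℕ} (hs : s ∈ 𝒜 i) (hi : 0 < i) :
      Flat (Proj.awayι 𝒜 s hs hi ≫ projStr 𝒜) := by
    rw [awayι_projStr, Flat.SpecMap_iff]
    let := (awayStr 𝒜 s).toAlgebra
    change Module.Flat R (HomogeneousLocalization.Away 𝒜 s)
    rw [IsDedekindDomain.flat_iff_torsion_eq_bot, Submodule.eq_bot_iff]
    intro x hx
    obtain ⟨⟨r, hr⟩, hx⟩ := hx
    obtain ⟨n, a, ha, rfl⟩ := x.mk_surjective _ hs
    have hx : awayStr 𝒜 s r * HomogeneousLocalization.Away.mk 𝒜 hs n a ha = 0 := hx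
    have hx := congr($(hx).val)
    rw [HomogeneousLocalization.val_mul, val_awayStr, HomogeneousLocalization.Away.val_mk,
      HomogeneousLocalization.val_zero, ← Localization.mk_one_eq_algebraMap, Localization.mk_mul,
      Localization.mk_eq_mk', IsLocalization.mk'_eq_zero_iff] at hx
    obtain ⟨⟨_, k, rfl⟩, hk⟩ := hx
    rw [HomogeneousLocalization.Away.mk_eq_zero_iff]
    refine ⟨k, h r _ (nonZeroDivisors.ne_zero hr) ?_⟩
    rw [← hk]
    simp only
    ring
  exact IsZariskiLocalAtSource.of_openCover (P := @Flat) (Proj.affineOpenCover 𝒜).openCover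
    fun s => hflat s.2.2 s.1.2

theorem isReduced_proj [_root_.IsReduced A] : AlgebraicGeometry.IsReduced (Proj 𝒜) := by
  have h (s : (Proj.affineOpenCover 𝒜).openCover.I₀) :
      AlgebraicGeometry.IsReduced ((Proj.affineOpenCover 𝒜).openCover.X s) := by
    have : _root_.IsReduced (HomogeneousLocalization.Away 𝒜 (s.2 : A)) := by
      exact isReduced_of_injective (algebraMap _ (Localization (Submonoid.powers (s.2 : A))))
        (HomogeneousLocalization.val_injective _)
    change AlgebraicGeometry.IsReduced (Spec (CommRingCat.of
      (HomogeneousLocalization.Away 𝒜 (s.2 : A))))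
    infer_instance
  exact IsReduced.of_openCover _ (Proj.affineOpenCover 𝒜).openCover

variable {R' B : Type} [CommRing R'] [CommRing B] [Algebra R' B] {ℬ : ℕ → Submodule R' B}
  [GradedAlgebra ℬ]

theorem awayMap_comp_awayStr (φ : R →+* R') (f : 𝒜 →+*ᵍ ℬ)
    (h : ∀ r, f (algebraMap R A r) = algebraMap R' B (φ r)) (s : A) :
    (HomogeneousLocalization.Away.map f s).comp (awayStr 𝒜 s) = (awayStr ℬ (f s)).comp φ := by
  ext r
  rw [RingHom.comp_apply, RingHom.comp_apply, val_awayStr, ← h, ← Localization.mk_one_eq_algebraMap]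
  have : awayStr 𝒜 s r = HomogeneousLocalization.mk (𝒜 := 𝒜)
      ⟨0, algebraMap R (𝒜 0) r, 1, Submonoid.one_mem _⟩ := rfl
  rw [this, HomogeneousLocalization.Away.map, HomogeneousLocalization.map_mk,
    HomogeneousLocalization.val_mk]
  congr 1
  exact Subtype.ext (map_one f : f 1 = 1)

/-- This transfers the hypothesis that every element of ker f is a multiple of π from the graded
ring to its charts. -/
theorem ker_awayMap_le (φ : R →+* R') (f : 𝒜 →+*ᵍ ℬ) (π : R) (hπ : φ π = 0)
    (hker : ∀ a, f a = 0 → ∃ b, a = algebraMap R A π * b) {s : A} {i : ℕ} (hs : s ∈ 𝒜 i) :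
    RingHom.ker (HomogeneousLocalization.Away.map f s) ≤ (RingHom.ker φ).map (awayStr 𝒜 s) := by
  intro x hx
  obtain ⟨n, a, ha, rfl⟩ := x.mk_surjective _ hs
  rw [RingHom.mem_ker, HomogeneousLocalization.Away.map_mk f s hs n a ha,
    HomogeneousLocalization.Away.mk_eq_zero_iff] at hx
  obtain ⟨k, hk⟩ := hx
  rw [← map_pow, ← map_mul] at hk
  obtain ⟨b, hb⟩ := hker _ hk
  have hmem : s ^ k * a ∈ 𝒜 ((k + n) • i) := by
    rw [add_smul]
    exact SetLike.mul_mem_graded (SetLike.pow_mem_graded k hs) ha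
  -- The cofactor b need not be homogeneous. Scalars have degree 0, so its component in the degree
  -- of s ^ k * a serves as well.
  have hb' : s ^ k * a = algebraMap R A π * (decompose 𝒜 b ((k + n) • i) : A) := by
    rw [← Algebra.smul_def] at hb ⊢
    rw [← decompose_of_mem_same 𝒜 hmem, hb, decompose_smul]
    rfl
  have : HomogeneousLocalization.Away.mk 𝒜 hs n a ha = awayStr 𝒜 s π *
      HomogeneousLocalization.Away.mk 𝒜 hs (k + n) _
        (SetLike.coe_mem (decompose 𝒜 b ((k + n) • i))) := by
    refine HomogeneousLocalization.val_injective _ ?_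
    rw [HomogeneousLocalization.val_mul, val_awayStr, HomogeneousLocalization.Away.val_mk,
      HomogeneousLocalization.Away.val_mk, ← Localization.mk_one_eq_algebraMap,
      Localization.mk_mul, ← hb', Localization.mk_eq_mk_iff, Localization.r_iff_exists]
    refine ⟨1, ?_⟩
    simp only [OneMemClass.coe_one, Submonoid.coe_mul]
    ring
  rw [this]
  exact Ideal.mul_mem_right _ _ (Ideal.mem_map_of_mem _ hπ)

theorem isPullback_awayι (f : 𝒜 →+*ᵍ ℬ) (hf : Function.Surjective f) {s : A} {i : ℕ}
    (hs : s ∈ 𝒜 i) (hi : 0 < i) :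
    IsPullback (Spec.map (CommRingCat.ofHom (HomogeneousLocalization.Away.map f s)))
      (Proj.awayι ℬ (f s) (f.map_mem hs) hi) (Proj.awayι 𝒜 s hs hi)
      (Proj.map f (f.irrelevant_le_map hf)) := by
  refine IsOpenImmersion.isPullback _ _ _ _ (Proj.awayι_comp_map f _ hi s hs) ?_
  rw [Proj.opensRange_awayι, Proj.opensRange_awayι, Proj.map_preimage_basicOpen]

theorem map_comp_projStr (φ : R →+* R') (f : 𝒜 →+*ᵍ ℬ) (hf : Function.Surjective f)
    (h : ∀ r, f (algebraMap R A r) = algebraMap R' B (φ r)) :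
    Proj.map f (f.irrelevant_le_map hf) ≫ projStr 𝒜 =
      projStr ℬ ≫ Spec.map (CommRingCat.ofHom φ) := by
  have H {s : A} {i : ℕ} (hs : s ∈ 𝒜 i) (hi : 0 < i) :
      Proj.awayι ℬ (f s) (f.map_mem hs) hi ≫ Proj.map f (f.irrelevant_le_map hf) ≫ projStr 𝒜 =
        Proj.awayι ℬ (f s) (f.map_mem hs) hi ≫ projStr ℬ ≫ Spec.map (CommRingCat.ofHom φ) := by
    rw [Proj.awayι_comp_map_assoc f _ hi s hs, awayι_projStr, awayι_projStr_assoc,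
      ← Spec.map_comp, ← Spec.map_comp, ← CommRingCat.ofHom_comp, ← CommRingCat.ofHom_comp,
      awayMap_comp_awayStr φ f h]
  exact (Proj.mapAffineOpenCover f (f.irrelevant_le_map hf)).openCover.hom_ext _ _
    fun s => H s.2.2 s.1.2

theorem isClosedImmersion_projMap (f : 𝒜 →+*ᵍ ℬ) (hf : Function.Surjective f) :
    IsClosedImmersion (Proj.map f (f.irrelevant_le_map hf)) := by
  have H {s : A} {i : ℕ} (hs : s ∈ 𝒜 i) (hi : 0 < i) : IsClosedImmersion
      (Limits.pullback.snd (Proj.map f (f.irrelevant_le_map hf)) (Proj.awayι 𝒜 s hs hi)) := by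
    have h1 : IsClosedImmersion
        (Spec.map (CommRingCat.ofHom (HomogeneousLocalization.Away.map f s))) :=
      IsClosedImmersion.spec_of_surjective _
        (HomogeneousLocalization.Away.map_surjective f hf hs)
    rw [← (isPullback_awayι f hf hs hi).flip.isoPullback_inv_snd]
    infer_instance
  exact IsZariskiLocalAtTarget.of_openCover (P := @IsClosedImmersion)
    (𝒰 := (Proj.affineOpenCover 𝒜).openCover) fun s => H s.2.2 s.1.2

/-- Over each chart D₊(s) of the target the square is the Spec of a pushout square of rings, and
pullback squares can be checked on an open cover. -/
theorem isPullback_projMap (φ : R →+* R') (f : 𝒜 →+*ᵍ ℬ) (hf : Function.Surjective f)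
    (hφ : Function.Surjective φ)
    (h : ∀ r, f (algebraMap R A r) = algebraMap R' B (φ r)) (π : R) (hπ : φ π = 0)
    (hker : ∀ a, f a = 0 → ∃ b, a = algebraMap R A π * b) :
    IsPullback (Proj.map f (f.irrelevant_le_map hf)) (projStr ℬ) (projStr 𝒜)
      (Spec.map (CommRingCat.ofHom φ)) := by
  have H {s : A} {i : ℕ} (hs : s ∈ 𝒜 i) (hi : 0 < i) : IsPullback
      (Limits.pullback.snd (Proj.map f (f.irrelevant_le_map hf)) (Proj.awayι 𝒜 s hs hi))
      (Limits.pullback.fst (Proj.map f (f.irrelevant_le_map hf)) (Proj.awayι 𝒜 s hs hi) ≫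
        projStr ℬ) (Proj.awayι 𝒜 s hs hi ≫ projStr 𝒜) (Spec.map (CommRingCat.ofHom φ)) := by
    have hp := (isPullback_awayι f hf hs hi).flip
    have key : IsPullback
        (Spec.map (CommRingCat.ofHom (HomogeneousLocalization.Away.map f s)))
        (Spec.map (CommRingCat.ofHom (awayStr ℬ (f s))))
        (Spec.map (CommRingCat.ofHom (awayStr 𝒜 s))) (Spec.map (CommRingCat.ofHom φ)) :=
      isPullback_SpecMap_of_isPushout _ _ _ _
        (CommRingCat.isPushout_of_surjective _ _ _ _ (awayMap_comp_awayStr φ f h _) hφ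
          (HomogeneousLocalization.Away.map_surjective f hf hs)
          (ker_awayMap_le φ f π hπ hker hs))
    refine key.of_iso hp.isoPullback (Iso.refl _) (Iso.refl _) (Iso.refl _) ?_ ?_ ?_ ?_
    · simp
    · simp [awayι_projStr]
    · simp [awayι_projStr]
    · simp
  exact Scheme.isPullback_of_openCover _ _ _ _ (Proj.affineOpenCover 𝒜).openCover
    fun s => H s.2.2 s.1.2

/-- A prime containing ker f is the preimage of its image, and that image is again prime. It stays
relevant because an irrelevant image would pull back to an irrelevant prime. -/
theorem ProjectiveSpectrum.range_comap (f : 𝒜 →+*ᵍ ℬ) (hf : Function.Surjective f) :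
    Set.range (ProjectiveSpectrum.comap f (f.irrelevant_le_map hf)) =
      ProjectiveSpectrum.zeroLocus 𝒜 (RingHom.ker f : Set A) := by
  ext p
  rw [ProjectiveSpectrum.mem_zeroLocus]
  constructor
  · rintro ⟨q, rfl⟩ a ha
    change f a ∈ q.asHomogeneousIdeal
    rw [RingHom.mem_ker.1 ha]
    exact Submodule.zero_mem q.asHomogeneousIdeal.toIdeal
  · intro hp
    have hker : RingHom.ker f ≤ p.asHomogeneousIdeal.toIdeal := hp
    have hcomap : (p.asHomogeneousIdeal.toIdeal.map f).comap f = p.asHomogeneousIdeal.toIdeal := by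
      rw [Ideal.comap_map_of_surjective f hf, sup_eq_left]
      exact hker
    refine ⟨⟨p.asHomogeneousIdeal.map f, Ideal.map_isPrime_of_surjective hf (H := p.isPrime) hker,
      fun hle => p.not_irrelevant_le ?_⟩,
      ProjectiveSpectrum.ext (HomogeneousIdeal.toIdeal_injective hcomap)⟩
    rw [HomogeneousIdeal.irrelevant_le]
    intro i hi x hx
    have : x ∈ (p.asHomogeneousIdeal.toIdeal.map f).comap f :=
      hle (HomogeneousIdeal.mem_irrelevant_of_mem _ hi (f.map_mem hx))
    rwa [hcomap] at this

theorem range_projMap (f : 𝒜 →+*ᵍ ℬ) (hf : Function.Surjective f) :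
    Set.range (Proj.map f (f.irrelevant_le_map hf)) =
      ProjectiveSpectrum.zeroLocus 𝒜 (RingHom.ker f : Set A) :=
  ProjectiveSpectrum.range_comap f hf

theorem isIrreducible_univ_proj [IsDomain A] {x : A} {i : ℕ} (hx : x ∈ 𝒜 i) (hi : 0 < i)
    (hx0 : x ≠ 0) : IsIrreducible (Set.univ : Set (Proj 𝒜)) := by
  let η : ProjectiveSpectrum 𝒜 :=
    ⟨⊥, Ideal.isPrime_bot, fun hle => hx0 (hle (HomogeneousIdeal.mem_irrelevant_of_mem _ hi hx))⟩
  have : closure {η} = (Set.univ : Set (ProjectiveSpectrum 𝒜)) := by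
    refine Set.eq_univ_of_forall fun y => ?_
    rw [← ProjectiveSpectrum.le_iff_mem_closure]
    exact (bot_le : (⊥ : Ideal A) ≤ y.asHomogeneousIdeal.toIdeal)
  have h2 : IsIrreducible (Set.univ : Set (ProjectiveSpectrum 𝒜)) := by
    rw [← this]
    exact isIrreducible_singleton.closure
  exact h2

end Proj

/-! ### The poset of index sequences is graded by weight -/

namespace GrIndex

variable {d n : ℕ}

/-- The sum of the entries of a sequence. -/
def weight (I : GrIndex d n) : ℕ := ∑ k, (I.1 k : ℕ)

theorem weight_strictMono : StrictMono (weight : GrIndex d n → ℕ) := by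
  intro I J h
  obtain ⟨k, hk⟩ : ∃ k, I.1 k < J.1 k := by
    by_contra! hc
    exact h.not_ge hc
  exact Finset.sum_lt_sum (fun i _ => h.le i) ⟨k, Finset.mem_univ _, hk⟩

theorem exists_weight_eq_add_one {I J : GrIndex d n} (h : I < J) :
    ∃ K, I < K ∧ K ≤ J ∧ K.weight = I.weight + 1 := by
  classical
  have hne : (Finset.univ.filter fun k => I.1 k < J.1 k).Nonempty := by
    by_contra hc
    simp only [Finset.not_nonempty_iff_eq_empty, Finset.filter_eq_empty_iff, Finset.mem_univ,
      true_implies, not_lt] at hc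
    exact h.not_ge hc
  -- The last position with I_k < J_k can be raised by one: any later entry of I is at least that of
  -- J, hence exceeds J_k, so there is room above I_k.
  obtain ⟨k, hk, hmax⟩ := Finset.exists_max_image _ id hne
  simp only [Finset.mem_filter, Finset.mem_univ, true_and, id] at hk hmax
  have hlt : (I.1 k : ℕ) + 1 < n := lt_of_le_of_lt hk (J.1 k).2
  have hmono : StrictMono (Function.update I.1 k ⟨I.1 k + 1, hlt⟩) := by
    intro a b hab
    rcases eq_or_ne a k with rfl | ha
    · rw [Function.update_self, Function.update_of_ne hab.ne']
      have h1 : J.1 b ≤ I.1 b := not_lt.1 fun hc => (hmax b hc).not_gt hab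
      have h2 : J.1 a < J.1 b := J.2 hab
      have h3 : (J.1 a : ℕ) < I.1 b := h2.trans_le h1
      have h4 : (I.1 a : ℕ) < J.1 a := hk
      exact Fin.lt_def.2 (by simp only; omega)
    · rw [Function.update_of_ne ha]
      rcases eq_or_ne b k with rfl | hb
      · rw [Function.update_self]
        have h1 : (I.1 a : ℕ) < I.1 b := I.2 hab
        exact Fin.lt_def.2 (by simp only; omega)
      · rw [Function.update_of_ne hb]
        exact I.2 hab
  have hs : weight ⟨_, hmono⟩ = I.weight + 1 := by
    simp only [weight]
    rw [← Finset.add_sum_erase _ _ (Finset.mem_univ k),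
      ← Finset.add_sum_erase (f := fun i => (I.1 i : ℕ)) _ (Finset.mem_univ k),
      Function.update_self]
    have : ∑ x ∈ Finset.univ.erase k, (Function.update I.1 k ⟨I.1 k + 1, hlt⟩ x : ℕ) =
        ∑ x ∈ Finset.univ.erase k, (I.1 x : ℕ) :=
      Finset.sum_congr rfl fun x hx => by rw [Function.update_of_ne (Finset.ne_of_mem_erase hx)]
    rw [this]
    simp only
    omega
  have hle : I ≤ ⟨_, hmono⟩ := by
    intro a
    change I.1 a ≤ Function.update I.1 k _ a
    rcases eq_or_ne a k with rfl | ha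
    · rw [Function.update_self]
      exact Fin.le_def.2 (Nat.le_succ _)
    · rw [Function.update_of_ne ha]
  refine ⟨⟨_, hmono⟩, lt_of_le_of_ne hle fun hc => ?_, fun a => ?_, hs⟩
  · rw [← hc] at hs
    omega
  · change Function.update I.1 k _ a ≤ J.1 a
    rcases eq_or_ne a k with rfl | ha
    · rw [Function.update_self]
      exact Fin.le_def.2 hk
    · rw [Function.update_of_ne ha]
      exact h.le a

theorem le_apply (I : GrIndex d n) (k : Fin d) : (k : ℕ) ≤ I.1 k := by
  obtain ⟨k, hk⟩ := k
  induction k with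
  | zero => exact Nat.zero_le _
  | succ k ih =>
    have h1 := ih (by omega)
    have h2 : I.1 ⟨k, by omega⟩ < I.1 ⟨k + 1, hk⟩ := I.2 (Fin.lt_def.2 (Nat.lt_succ_self k))
    have h3 := Fin.lt_def.1 h2
    simp only at h1 ⊢
    omega

theorem apply_add_le (I : GrIndex d n) (k : Fin d) : (I.1 k : ℕ) + d ≤ n + k := by
  obtain ⟨j, hj⟩ : ∃ j, (k : ℕ) + j + 1 = d := ⟨d - 1 - k, by omega⟩
  induction j generalizing k with
  | zero => have := (I.1 k).2; omega
  | succ j ih =>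
    have h1 := ih ⟨k + 1, by omega⟩ (by simp only; omega)
    have h2 : I.1 k < I.1 ⟨k + 1, by omega⟩ := I.2 (Fin.lt_def.2 (Nat.lt_succ_self k))
    have h3 := Fin.lt_def.1 h2
    simp only at h1
    omega

/-- The smallest sequence. -/
def least (h : d ≤ n) : GrIndex d n := ⟨Fin.castLE h, Fin.strictMono_castLE h⟩

/-- The largest sequence. -/
def greatest (h : d ≤ n) : GrIndex d n :=
  ⟨fun k => ⟨n - d + k, by omega⟩, fun a b hab => Fin.lt_def.2 (by
    simpa using Fin.lt_def.1 hab)⟩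

theorem least_le (h : d ≤ n) (I : GrIndex d n) : least h ≤ I := fun k => I.le_apply k

theorem le_greatest (h : d ≤ n) (I : GrIndex d n) : I ≤ greatest h := fun k => by
  have := I.apply_add_le k
  exact Fin.le_def.2 (by simp only [greatest]; omega)

theorem weight_greatest (h : d ≤ n) :
    (greatest h).weight = (least h).weight + d * (n - d) := by
  simp [weight, greatest, least, Finset.sum_add_distrib, add_comm]

/-- A maximal chain skips no weight. Across a gap one could insert an element one weight above the
last member before the gap; it is comparable with the whole chain, so maximality puts it in the
chain. -/
theorem image_weight_flag (h : d ≤ n) (C : Flag (GrIndex d n)) :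
    weight '' (C : Set (GrIndex d n)) = Set.Icc (least h).weight (greatest h).weight := by
  apply Set.Subset.antisymm
  · rintro _ ⟨I, -, rfl⟩
    exact ⟨weight_strictMono.monotone (least_le h I), weight_strictMono.monotone (le_greatest h I)⟩
  · rintro v ⟨hv1, hv2⟩
    by_contra hv
    have hbot : least h ∈ C := Flag.mem_iff_forall_le_or_ge.2 fun J _ => Or.inl (least_le h J)
    have htop : greatest h ∈ C := Flag.mem_iff_forall_le_or_ge.2 fun J _ => Or.inr (le_greatest h J)
    have hne (J) (hJ : J ∈ C) : J.weight ≠ v := fun hc => hv ⟨J, hJ, hc⟩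
    obtain ⟨I, ⟨hIC, hIv⟩, hI⟩ := Set.exists_max_image {J | J ∈ C ∧ J.weight < v} weight
      (Set.toFinite _) ⟨_, hbot, lt_of_le_of_ne hv1 (hne _ hbot)⟩
    obtain ⟨J, ⟨hJC, hJv⟩, hJ⟩ := Set.exists_min_image {J | J ∈ C ∧ v < J.weight} weight
      (Set.toFinite _) ⟨_, htop, lt_of_le_of_ne hv2 (hne _ htop).symm⟩
    have hIJ : I < J := by
      rcases C.le_or_le hIC hJC with hc | hc
      · exact lt_of_le_of_ne hc fun hc => by rw [hc] at hIv; omega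
      · have := weight_strictMono.monotone hc
        omega
    obtain ⟨K, hIK, hKJ, hK⟩ := exists_weight_eq_add_one hIJ
    have hKC : K ∈ C := by
      refine Flag.mem_iff_forall_le_or_ge.2 fun L hL => ?_
      rcases lt_or_gt_of_ne (hne L hL) with hc | hc
      · right
        have h1 := hI L ⟨hL, hc⟩
        rcases C.le_or_le hL hIC with h2 | h2
        · exact h2.trans hIK.le
        · rcases h2.lt_or_eq with h3 | h3
          · have := weight_strictMono h3
            omega
          · exact h3 ▸ hIK.le
      · left
        have h1 := hJ L ⟨hL, hc⟩
        rcases C.le_or_le hJC hL with h2 | h2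
        · exact hKJ.trans h2
        · rcases h2.lt_or_eq with h3 | h3
          · have := weight_strictMono h3
            omega
          · exact h3 ▸ hKJ
    have h1 := hne K hKC
    have h2 := hI K
    simp only [Set.mem_ofPred_eq] at h2
    have h3 : ¬ K.weight < v := fun hc => by
      have := h2 ⟨hKC, hc⟩
      omega
    omega

theorem injOn_weight_flag (C : Flag (GrIndex d n)) :
    Set.InjOn weight (C : Set (GrIndex d n)) := by
  intro I hI J hJ hIJ
  rcases C.le_or_le hI hJ with hc | hc
  · exact hc.eq_of_not_lt fun hlt => (weight_strictMono hlt).ne hIJ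
  · exact (hc.eq_of_not_lt fun hlt => (weight_strictMono hlt).ne hIJ.symm).symm

theorem ncard_flag (h : d ≤ n) (C : Flag (GrIndex d n)) :
    Nat.card (C : Set (GrIndex d n)) = d * (n - d) + 1 := by
  rw [Nat.card_coe_set_eq, ← (injOn_weight_flag C).ncard_image, image_weight_flag h,
    weight_greatest, Set.ncard_eq_toFinset_card']
  simp
  omega

/-- An enumeration of the members of a maximal chain. -/
noncomputable def flagEquiv (h : d ≤ n) (C : Flag (GrIndex d n)) :
    (C : Set (GrIndex d n)) ≃ Fin (d * (n - d) + 1) :=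
  Finite.equivFinOfCardEq (ncard_flag h C)

end GrIndex

/-! ### Maximal minors and the straightening law -/

section Minors

variable {d n : ℕ}

/-- The maximal minor of a matrix on a sequence of columns. -/
def Matrix.maximalMinor {R : Type*} [CommRing R] (A : Matrix (Fin d) (Fin n) R)
    (f : Fin d → Fin n) : R :=
  (A.submatrix id f).det

theorem Matrix.maximalMinor_comp_perm {R : Type*} [CommRing R] (A : Matrix (Fin d) (Fin n) R)
    (f : Fin d → Fin n) (τ : Equiv.Perm (Fin d)) :
    A.maximalMinor (f ∘ τ) = Equiv.Perm.sign τ * A.maximalMinor f :=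
  Matrix.det_permute' τ (A.submatrix id f)

theorem Matrix.maximalMinor_eq_zero_or {R : Type*} [CommRing R] (f : Fin d → Fin n) :
    (∀ A : Matrix (Fin d) (Fin n) R, A.maximalMinor f = 0) ∨
      ∃ (K : GrIndex d n) (u : ℤˣ), K.weight = ∑ k, (f k : ℕ) ∧
        ∀ A : Matrix (Fin d) (Fin n) R, A.maximalMinor f = u * A.maximalMinor K.1 := by
  by_cases hf : Function.Injective f
  · right
    have hm : StrictMono (f ∘ Tuple.sort f) :=
      (Tuple.monotone_sort f).strictMono_of_injective (hf.comp (Tuple.sort f).injective)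
    refine ⟨⟨_, hm⟩, Equiv.Perm.sign (Tuple.sort f),
      Equiv.sum_comp (Tuple.sort f) fun k => (f k : ℕ), fun A => ?_⟩
    rw [Matrix.maximalMinor_comp_perm, ← mul_assoc, ← Int.cast_mul, ← Units.val_mul,
      Int.units_mul_self]
    simp
  · left
    intro A
    obtain ⟨a, b, hab, hne⟩ : ∃ a b, f a = f b ∧ a ≠ b := by
      simpa [Function.Injective] using hf
    exact Matrix.det_zero_of_column_eq hne fun i => by simp [hab]

/-- The alternating sum, over the permutations of more than `d` of the columns of two maximal
minors, of the products of the minors, vanishes. -/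
theorem Matrix.sum_sign_maximalMinor_mul {F : Type*} [Field F] (A : Matrix (Fin d) (Fin n) F)
    (c : Fin d ⊕ Fin d → Fin n) (p : Fin d ⊕ Fin d → Prop) [DecidablePred p]
    (hp : d < Fintype.card {x // p x}) :
    ∑ σ : Equiv.Perm {x // p x}, (Equiv.Perm.sign σ : ℤ) •
      (A.maximalMinor (fun k => c (Equiv.Perm.ofSubtype σ (Sum.inl k))) *
        A.maximalMinor (fun k => c (Equiv.Perm.ofSubtype σ (Sum.inr k)))) = 0 := by
  let D : MultilinearMap F (fun _ : Fin d => Fin d → F) F :=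
    (Matrix.detRowAlternating : (Fin d → F) [⋀^Fin d]→ₗ[F] F).toMultilinearMap
  let M : MultilinearMap F (fun _ : Fin d ⊕ Fin d => Fin d → F) F :=
    (LinearMap.mul' F F).compMultilinearMap (D.domCoprod D)
  let m := M.domDomRestrict p fun x => A.transpose (c x)
  -- More than d vectors in a d-dimensional space are dependent, so any alternating map kills them.
  have hz : MultilinearMap.alternatization m (fun x => A.transpose (c x)) = 0 := by
    refine AlternatingMap.map_linearDependent _ _ fun hli => ?_
    have := hli.fintype_card_le_finrank
    rw [Module.finrank_fintype_fun_eq_card, Fintype.card_fin] at this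
    omega
  rw [MultilinearMap.alternatization_apply] at hz
  rw [← hz]
  refine Finset.sum_congr rfl fun σ _ => ?_
  have key : ∀ x, (if h : p x then A.transpose (c (σ ⟨x, h⟩)) else A.transpose (c x)) =
      A.transpose (c (Equiv.Perm.ofSubtype σ x)) := by
    intro x
    split_ifs with h
    · rw [Equiv.Perm.ofSubtype_apply_of_mem _ h]
    · rw [Equiv.Perm.ofSubtype_apply_of_not_mem _ h]
  change _ = (Equiv.Perm.sign σ) • (
    (D fun k => if h : p (Sum.inl k) then A.transpose (c (σ ⟨Sum.inl k, h⟩))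
      else A.transpose (c (Sum.inl k))) *
    (D fun k => if h : p (Sum.inr k) then A.transpose (c (σ ⟨Sum.inr k, h⟩))
      else A.transpose (c (Sum.inr k))))
  simp only [key]
  have hD (f : Fin d → Fin n) : A.maximalMinor f = D fun k => A.transpose (f k) :=
    (Matrix.det_transpose (A.submatrix id f)).symm
  rw [hD, hD]
  rfl

/-- Columns entering the left block come from j_b with b ≤ k, so they are at most j_k < i_k; columns
leaving it are i_a with a ≥ k, so they are at least i_k. Equally many enter and leave, and at least
one does. -/
theorem Matrix.sum_lt_of_perm (I J : GrIndex d n) {k : Fin d} (hk : J.1 k < I.1 k)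
    (π : Equiv.Perm (Fin d ⊕ Fin d))
    (hl : ∀ a, a < k → π (Sum.inl a) = Sum.inl a) (hr : ∀ b, k < b → π (Sum.inr b) = Sum.inr b)
    (hπ : ¬ Set.MapsTo π (Set.range Sum.inl) (Set.range Sum.inl)) :
    ∑ a, ((Sum.elim I.1 J.1 (π (Sum.inl a)) : Fin n) : ℕ) < I.weight := by
  classical
  let c : Fin d ⊕ Fin d → ℕ := fun x => ((Sum.elim I.1 J.1 x : Fin n) : ℕ)
  let L : Finset (Fin d ⊕ Fin d) := Finset.univ.image Sum.inl
  let T : Finset (Fin d ⊕ Fin d) := L.map π.toEmbedding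
  have hT : ∑ a, ((Sum.elim I.1 J.1 (π (Sum.inl a)) : Fin n) : ℕ) = ∑ x ∈ T, c x := by
    rw [Finset.sum_map, Finset.sum_image fun a _ b _ h => Sum.inl_injective h]
    rfl
  have hL : I.weight = ∑ x ∈ L, c x := by
    rw [Finset.sum_image fun a _ b _ h => Sum.inl_injective h]
    rfl
  have hcard : (T \ L).card = (L \ T).card :=
    Finset.card_sdiff_comm (Finset.card_map _)
  have hne : (T \ L).Nonempty := by
    obtain ⟨_, ⟨a, rfl⟩, ha⟩ : ∃ x ∈ Set.range Sum.inl, π x ∉ Set.range Sum.inl := by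
      simpa [Set.MapsTo] using hπ
    refine ⟨π (Sum.inl a), Finset.mem_sdiff.2 ⟨Finset.mem_map_of_mem _ (by simp [L]), fun h => ?_⟩⟩
    simp only [L, Finset.mem_image, Finset.mem_univ, true_and] at h
    exact ha h
  have h1 : ∑ x ∈ T \ L, c x < (T \ L).card * (I.1 k : ℕ) := by
    rw [← smul_eq_mul, ← Finset.sum_const]
    refine Finset.sum_lt_sum_of_nonempty hne fun x hx => ?_
    rw [Finset.mem_sdiff] at hx
    rcases x with a | b
    · exact absurd (by simp [L]) hx.2
    · have hb : b ≤ k := by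
        by_contra hb
        have h2 := hr b (not_le.1 hb)
        obtain ⟨y, hy, hyb⟩ := Finset.mem_map.1 hx.1
        have : y = Sum.inr b := π.injective (hyb.trans h2.symm)
        simp [L, this] at hy
      have h3 : J.1 b ≤ J.1 k := J.2.monotone hb
      exact Fin.lt_def.1 (h3.trans_lt hk)
  have h2 : (L \ T).card * (I.1 k : ℕ) ≤ ∑ x ∈ L \ T, c x := by
    rw [← smul_eq_mul, ← Finset.sum_const]
    refine Finset.sum_le_sum fun x hx => ?_
    rw [Finset.mem_sdiff] at hx
    rcases x with a | b
    · have ha : k ≤ a := by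
        by_contra ha
        exact hx.2 (Finset.mem_map.2 ⟨Sum.inl a, hx.1, hl a (not_le.1 ha)⟩)
      exact Fin.le_def.1 (I.2.monotone ha)
    · simp [L] at hx
  rw [hT, hL, ← Finset.sum_inter_add_sum_sdiff T L, ← Finset.sum_inter_add_sum_sdiff L T,
    Finset.inter_comm L T]
  rw [hcard] at h1
  omega

/-- The straightening law: a product of two minors on incomparable sequences is a linear
combination of products of minors with larger sums of squares of weights. -/
theorem Matrix.maximalMinor_mul_mem_span (I J : GrIndex d n) (hIJ : ¬ I ≤ J)
    (hw : I.weight ≤ J.weight) :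
    (fun A : Matrix (Fin d) (Fin n) ℂ => A.maximalMinor I.1 * A.maximalMinor J.1) ∈
      Submodule.span ℂ {F : Matrix (Fin d) (Fin n) ℂ → ℂ | ∃ K L : GrIndex d n,
        I.weight ^ 2 + J.weight ^ 2 < K.weight ^ 2 + L.weight ^ 2 ∧
          F = fun A => A.maximalMinor K.1 * A.maximalMinor L.1} := by
  classical
  set V := Submodule.span ℂ {F : Matrix (Fin d) (Fin n) ℂ → ℂ | ∃ K L : GrIndex d n,
        I.weight ^ 2 + J.weight ^ 2 < K.weight ^ 2 + L.weight ^ 2 ∧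
          F = fun A => A.maximalMinor K.1 * A.maximalMinor L.1}
  obtain ⟨k, hk⟩ : ∃ k, J.1 k < I.1 k := by
    by_contra! hc
    exact hIJ hc
  -- The exchanged columns are i_k, …, i_d and j_1, …, j_k: exactly d + 1 of them.
  let p : Fin d ⊕ Fin d → Prop := Sum.elim (fun a => k ≤ a) (fun b => b ≤ k)
  have hcard : d < Fintype.card {x // p x} := by
    rw [Fintype.card_subtype, ← Finset.card_toLeft_add_card_toRight]
    have e1 : (Finset.univ.filter p).toLeft = Finset.Ici k := by ext; simp [p]
    have e2 : (Finset.univ.filter p).toRight = Finset.Iic k := by ext; simp [p]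
    rw [e1, e2, Fin.card_Ici, Fin.card_Iic]
    omega
  let c : Fin d ⊕ Fin d → Fin n := Sum.elim I.1 J.1
  let t (σ : Equiv.Perm {x // p x}) (A : Matrix (Fin d) (Fin n) ℂ) : ℂ :=
    (Equiv.Perm.sign σ : ℤ) •
      (A.maximalMinor (fun k => c (Equiv.Perm.ofSubtype σ (Sum.inl k))) *
        A.maximalMinor (fun k => c (Equiv.Perm.ofSubtype σ (Sum.inr k))))
  let good : Finset (Equiv.Perm {x // p x}) := Finset.univ.filter fun σ =>
    Set.MapsTo (Equiv.Perm.ofSubtype σ) (Set.range Sum.inl) (Set.range Sum.inl)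
  have hsum : ∑ σ, t σ = 0 := by
    ext A
    rw [Finset.sum_apply]
    exact A.sum_sign_maximalMinor_mul c p hcard
  -- A block-preserving permutation reorders the columns within each minor, and the two resulting
  -- signs cancel the sign of σ.
  have hgood : ∀ σ ∈ good, t σ = fun A => A.maximalMinor I.1 * A.maximalMinor J.1 := by
    intro σ hσ
    ext A
    obtain ⟨⟨τ₁, τ₂⟩, hτ⟩ := Equiv.Perm.mem_sumCongrHom_range_of_perm_mapsTo_inl
      (Finset.mem_filter.1 hσ).2
    have hs : Equiv.Perm.sign σ = Equiv.Perm.sign τ₁ * Equiv.Perm.sign τ₂ := by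
      rw [← Equiv.Perm.sign_ofSubtype, ← hτ, Equiv.Perm.sumCongrHom_apply,
        Equiv.Perm.sign_sumCongr]
    have e1 : (fun k => c (Equiv.Perm.ofSubtype σ (Sum.inl k))) = I.1 ∘ τ₁ := by
      rw [← hτ]; rfl
    have e2 : (fun k => c (Equiv.Perm.ofSubtype σ (Sum.inr k))) = J.1 ∘ τ₂ := by
      rw [← hτ]; rfl
    simp only [t]
    rw [e1, e2, Matrix.maximalMinor_comp_perm, Matrix.maximalMinor_comp_perm, hs, zsmul_eq_mul]
    rcases Int.units_eq_one_or (Equiv.Perm.sign τ₁) with h1 | h1 <;>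
    rcases Int.units_eq_one_or (Equiv.Perm.sign τ₂) with h2 | h2 <;> simp [h1, h2]
  have hbad : ∀ σ ∈ goodᶜ, t σ ∈ V := by
    intro σ hσ
    have hσ : ¬ Set.MapsTo (Equiv.Perm.ofSubtype σ) (Set.range Sum.inl) (Set.range Sum.inl) := by
      simpa [good] using hσ
    have hlt := Matrix.sum_lt_of_perm I J hk (Equiv.Perm.ofSubtype σ)
      (fun a ha => Equiv.Perm.ofSubtype_apply_of_not_mem _ (by simpa [p] using ha))
      (fun b hb => Equiv.Perm.ofSubtype_apply_of_not_mem _ (by simpa [p] using hb)) hσ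
    have htot : ∑ a, (c (Equiv.Perm.ofSubtype σ (Sum.inl a)) : ℕ) +
        ∑ a, (c (Equiv.Perm.ofSubtype σ (Sum.inr a)) : ℕ) = I.weight + J.weight := by
      rw [← Fintype.sum_sum_type fun x => (c (Equiv.Perm.ofSubtype σ x) : ℕ),
        Equiv.sum_comp (Equiv.Perm.ofSubtype σ) fun x => (c x : ℕ), Fintype.sum_sum_type]
      rfl
    rcases Matrix.maximalMinor_eq_zero_or (R := ℂ)
      (fun k => c (Equiv.Perm.ofSubtype σ (Sum.inl k))) with h1 | ⟨K, u, hK, h1⟩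
    · have : t σ = 0 := by ext A; simp [t, h1]
      rw [this]
      exact zero_mem _
    rcases Matrix.maximalMinor_eq_zero_or (R := ℂ)
      (fun k => c (Equiv.Perm.ofSubtype σ (Sum.inr k))) with h2 | ⟨L, v, hL, h2⟩
    · have : t σ = 0 := by ext A; simp [t, h2]
      rw [this]
      exact zero_mem _
    have : t σ = (((Equiv.Perm.sign σ : ℤ) : ℂ) * ((u : ℤ) : ℂ) * ((v : ℤ) : ℂ)) •
        fun A : Matrix (Fin d) (Fin n) ℂ => A.maximalMinor K.1 * A.maximalMinor L.1 := by
      ext A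
      simp only [t, h1, h2, Pi.smul_apply, smul_eq_mul, zsmul_eq_mul]
      ring
    rw [this]
    refine Submodule.smul_mem _ _ (Submodule.subset_span ⟨K, L, ?_, rfl⟩)
    change ∑ a, (c (Equiv.Perm.ofSubtype σ (Sum.inl a)) : ℕ) < _ at hlt
    rw [← hK] at hlt htot
    rw [← hL] at htot
    -- The weights move from (w(I), w(J)) to (w(I) - e - 1, w(J) + e + 1). Since w(I) ≤ w(J), this
    -- spreads them apart and increases the sum of squares.
    obtain ⟨e, he⟩ := Nat.exists_eq_add_of_lt hlt
    have hL' : L.weight = J.weight + e + 1 := by omega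
    rw [hL', he]
    nlinarith
  -- The product p_I p_J occurs once for each good permutation, so solving for it divides by their
  -- number; the identity is among them.
  have hN : (good.card : ℂ) ≠ 0 := by
    rw [Nat.cast_ne_zero, Finset.card_ne_zero]
    exact ⟨1, Finset.mem_filter.2 ⟨Finset.mem_univ _, by rw [map_one]; exact Set.mapsTo_id _⟩⟩
  rw [← Finset.sum_add_sum_compl good, Finset.sum_congr rfl hgood, Finset.sum_const] at hsum
  have hmem := V.neg_mem (V.sum_mem hbad)
  rw [← eq_neg_of_add_eq_zero_left hsum, ← Nat.cast_smul_eq_nsmul ℂ] at hmem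
  exact (V.smul_mem_iff hN).1 hmem

end Minors

/-! ### Linear independence of the standard monomials -/

section StandardMonomials

variable {d n : ℕ}

/-- The matrix of variables; its entries are ordered row by row. -/
noncomputable def genericMatrix (d n : ℕ) :
    Matrix (Fin d) (Fin n) (MvPolynomial (Fin d ×ₗ Fin n) ℂ) :=
  Matrix.of fun a j => MvPolynomial.X (toLex (a, j))

namespace GrIndex

/-- The exponent of the diagonal term of the minor on the columns `I`. -/
noncomputable def diagExp (I : GrIndex d n) : (Fin d ×ₗ Fin n) →₀ ℕ :=
  ∑ a, Finsupp.single (toLex (a, I.1 a)) 1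

theorem diagExp_apply (I : GrIndex d n) (a : Fin d) (j : Fin n) :
    I.diagExp (toLex (a, j)) = if I.1 a = j then 1 else 0 := by
  rw [diagExp, Finsupp.finsetSum_apply, Finset.sum_eq_single a]
  · simp [Finsupp.single_apply]
  · intro b _ hb
    simp [hb]
  · simp

/-- The exponent of the term of the minor on the columns `I` attached to a permutation. -/
noncomputable def permExp (I : GrIndex d n) (σ : Equiv.Perm (Fin d)) : (Fin d ×ₗ Fin n) →₀ ℕ :=
  ∑ a, Finsupp.single (toLex (σ a, I.1 a)) 1

theorem permExp_apply (I : GrIndex d n) (σ : Equiv.Perm (Fin d)) (a : Fin d) (j : Fin n) :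
    I.permExp σ (toLex (a, j)) = if I.1 (σ.symm a) = j then 1 else 0 := by
  rw [permExp, Finsupp.finsetSum_apply, Finset.sum_eq_single (σ.symm a)]
  · simp [Finsupp.single_apply]
  · intro b _ hb
    have : σ b ≠ a := fun h => hb (by rw [← h, Equiv.symm_apply_apply])
    simp [this]
  · simp

theorem permExp_one (I : GrIndex d n) : I.permExp 1 = I.diagExp := rfl

-- In the first row a where the permuted term departs from the diagonal, its column lies strictly to
-- the right of I_a. So the two exponents first differ at the variable (a, I_a), which only the
-- diagonal term contains.
open MonomialOrder in
theorem permExp_lt (I : GrIndex d n) {σ : Equiv.Perm (Fin d)} (hσ : σ ≠ 1) :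
    I.permExp σ ≺[lex] I.diagExp := by
  obtain ⟨a₀, ha₀⟩ : ∃ a, σ.symm a ≠ a := by
    by_contra! h
    exact hσ (Equiv.ext fun a => by
      rw [Equiv.Perm.one_apply, ← σ.eq_symm_apply, h])
  obtain ⟨a, ha, hmin⟩ := Set.exists_min_image {a | σ.symm a ≠ a} id (Set.toFinite _) ⟨a₀, ha₀⟩
  have hfix (b : Fin d) (hb : b < a) : σ.symm b = b := by
    by_contra h
    exact (hmin b h).not_gt hb
  have hlt : a < σ.symm a := by
    rcases lt_trichotomy a (σ.symm a) with h | h | h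
    · exact h
    · exact absurd h.symm ha
    · exact absurd (σ.symm.injective (hfix _ h)) ha
  rw [MonomialOrder.lex_lt_iff, Finsupp.Lex.lt_iff]
  refine ⟨toLex (a, I.1 a), fun x hx => ?_, ?_⟩
  · obtain ⟨⟨b, j⟩, rfl⟩ := toLex.surjective x
    rw [Prod.Lex.toLex_lt_toLex] at hx
    change I.permExp σ (toLex (b, j)) = I.diagExp (toLex (b, j))
    rw [permExp_apply, diagExp_apply]
    rcases hx with h | ⟨rfl, h⟩
    · rw [hfix b h]
    · rw [if_neg, if_neg h.ne']
      exact (h.trans (I.2 hlt)).ne'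
  · change I.permExp σ (toLex (a, I.1 a)) < I.diagExp (toLex (a, I.1 a))
    rw [permExp_apply, diagExp_apply, if_pos rfl, if_neg (I.2 hlt).ne']
    exact Nat.one_pos

theorem genericMinor_eq (I : GrIndex d n) : (genericMatrix d n).maximalMinor I.1 =
    ∑ σ, MvPolynomial.monomial (I.permExp σ) ((Equiv.Perm.sign σ : ℤ) : ℂ) := by
  rw [Matrix.maximalMinor, Matrix.det_apply']
  refine Finset.sum_congr rfl fun σ _ => ?_
  have : ((((Equiv.Perm.sign σ : ℤ)) : ℤ) : MvPolynomial (Fin d ×ₗ Fin n) ℂ) =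
      MvPolynomial.C ((Equiv.Perm.sign σ : ℤ) : ℂ) := by simp
  rw [this, permExp, ← mul_one ((Equiv.Perm.sign σ : ℤ) : ℂ), ← MvPolynomial.C_mul_monomial,
    MvPolynomial.monomial_sum_one, mul_one]
  rfl

theorem coeff_genericMinor (I : GrIndex d n) :
    ((genericMatrix d n).maximalMinor I.1).coeff I.diagExp = 1 := by
  rw [genericMinor_eq, MvPolynomial.coeff_sum, Finset.sum_eq_single 1]
  · simp [permExp_one]
  · intro σ _ hσ
    rw [MvPolynomial.coeff_monomial, if_neg]
    intro h
    have := I.permExp_lt hσ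
    rw [h] at this
    exact lt_irrefl _ this
  · simp

theorem degree_genericMinor (I : GrIndex d n) :
    MonomialOrder.lex.degree ((genericMatrix d n).maximalMinor I.1) = I.diagExp := by
  apply MonomialOrder.lex.toSyn.injective
  refine le_antisymm (MonomialOrder.lex.degree_le_iff.2 fun c hc => ?_)
    (MonomialOrder.lex.le_degree (by
      rw [MvPolynomial.mem_support_iff, coeff_genericMinor]
      exact one_ne_zero))
  rw [MvPolynomial.mem_support_iff, genericMinor_eq, MvPolynomial.coeff_sum] at hc
  obtain ⟨σ, -, hσ⟩ := Finset.exists_ne_zero_of_sum_ne_zero hc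
  rw [MvPolynomial.coeff_monomial] at hσ
  obtain rfl : I.permExp σ = c := by
    by_contra h
    exact hσ (if_neg h)
  rcases eq_or_ne σ 1 with rfl | h
  · exact le_rfl
  · exact (I.permExp_lt h).le

theorem monic_genericMinor (I : GrIndex d n) :
    MonomialOrder.lex.Monic ((genericMatrix d n).maximalMinor I.1) := by
  rw [MonomialOrder.Monic, MonomialOrder.leadingCoeff, degree_genericMinor, coeff_genericMinor]

end GrIndex

/-- A monomial in the Plücker coordinates is standard if its variables form a chain. -/
def IsStandard (m : GrIndex d n →₀ ℕ) : Prop := IsChain (· ≤ ·) (m.support : Set (GrIndex d n))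

theorem IsStandard.of_add {m₁ m₂ : GrIndex d n →₀ ℕ} (h : IsStandard (m₁ + m₂)) :
    IsStandard m₁ := by
  refine IsChain.mono (fun I hI => ?_) h
  simp only [Finset.mem_coe, Finsupp.mem_support_iff, Finsupp.add_apply] at hI ⊢
  omega

/-- The exponent of the leading monomial of a monomial in the minors. -/
noncomputable def leadExp (m : GrIndex d n →₀ ℕ) : (Fin d ×ₗ Fin n) →₀ ℕ :=
  m.sum fun I k => k • I.diagExp

theorem leadExp_add (m₁ m₂ : GrIndex d n →₀ ℕ) : leadExp (m₁ + m₂) = leadExp m₁ + leadExp m₂ :=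
  Finsupp.sum_add_index' (fun _ => zero_smul _ _) fun _ _ _ => add_smul _ _ _

theorem leadExp_apply_ne_zero {m : GrIndex d n →₀ ℕ} {a : Fin d} {j : Fin n} :
    leadExp m (toLex (a, j)) ≠ 0 ↔ ∃ I ∈ m.support, I.1 a = j := by
  rw [leadExp, Finsupp.sum, Finsupp.finsetSum_apply, Ne, Finset.sum_eq_zero_iff]
  push Not
  refine exists_congr fun I => and_congr_right fun hI => ?_
  rw [Finsupp.smul_apply, GrIndex.diagExp_apply]
  rw [Finsupp.mem_support_iff] at hI
  split_ifs with h <;> simp [h, hI]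

theorem IsStandard.exists_greatest {m : GrIndex d n →₀ ℕ} (h : IsStandard m) (h0 : m ≠ 0) :
    ∃ T ∈ m.support, ∀ I ∈ m.support, I ≤ T := by
  obtain ⟨T, hT, hmax⟩ := Finset.exists_max_image m.support GrIndex.weight
    (Finsupp.support_nonempty_iff.2 h0)
  refine ⟨T, hT, fun I hI => ?_⟩
  rcases h.total hI hT with hc | hc
  · exact hc
  · exact (hc.eq_of_not_lt fun hlt => (hmax I hI).not_gt (GrIndex.weight_strictMono hlt)).ge

/-- Row a of the leading exponent records the a-th entries of the factors. In a chain the largest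
factor has the largest entry in every row, so the exponent determines it; it is split off and
induction on the degree finishes. A row must exist, whence `1 ≤ d`. -/
theorem leadExp_injOn (hd : 1 ≤ d) {m₁ m₂ : GrIndex d n →₀ ℕ} (h₁ : IsStandard m₁)
    (h₂ : IsStandard m₂) (h : leadExp m₁ = leadExp m₂) : m₁ = m₂ := by
  induction hN : m₁.degree generalizing m₁ m₂ with
  | zero =>
    obtain rfl : m₁ = 0 := (Finsupp.degree_eq_zero_iff _).1 hN
    by_contra hne
    obtain ⟨T, hT, -⟩ := h₂.exists_greatest (Ne.symm hne)
    have := (leadExp_apply_ne_zero (a := ⟨0, hd⟩)).2 ⟨T, hT, rfl⟩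
    rw [← h] at this
    simp [leadExp] at this
  | succ N ih =>
    have h1 : m₁ ≠ 0 := by
      rintro rfl
      simp at hN
    obtain ⟨T, hT, hTmax⟩ := h₁.exists_greatest h1
    have h2 : m₂ ≠ 0 := by
      rintro rfl
      have := (leadExp_apply_ne_zero (a := ⟨0, hd⟩)).2 ⟨T, hT, rfl⟩
      rw [h] at this
      simp [leadExp] at this
    obtain ⟨T', hT', hTmax'⟩ := h₂.exists_greatest h2
    obtain rfl : T = T' := by
      apply le_antisymm
      · intro a
        have := (leadExp_apply_ne_zero (a := a)).2 ⟨T, hT, rfl⟩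
        rw [h] at this
        obtain ⟨I, hI, hIa⟩ := leadExp_apply_ne_zero.1 this
        rw [← hIa]
        exact hTmax' I hI a
      · intro a
        have := (leadExp_apply_ne_zero (a := a)).2 ⟨T', hT', rfl⟩
        rw [← h] at this
        obtain ⟨I, hI, hIa⟩ := leadExp_apply_ne_zero.1 this
        rw [← hIa]
        exact hTmax I hI a
    have hle {m : GrIndex d n →₀ ℕ} (hm : T ∈ m.support) : Finsupp.single T 1 ≤ m := by
      rw [Finsupp.single_le_iff]
      exact Nat.one_le_iff_ne_zero.2 (Finsupp.mem_support_iff.1 hm)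
    obtain ⟨k₁, rfl⟩ := exists_add_of_le (hle hT)
    obtain ⟨k₂, rfl⟩ := exists_add_of_le (hle hT')
    rw [leadExp_add, leadExp_add, add_right_inj] at h
    rw [add_comm] at h₁ h₂
    rw [ih h₁.of_add h₂.of_add h]
    simp only [map_add, Finsupp.degree_single] at hN
    omega

theorem monic_genericMonomial (m : GrIndex d n →₀ ℕ) : MonomialOrder.lex.Monic
    (m.prod fun I k => (genericMatrix d n).maximalMinor I.1 ^ k) :=
  MonomialOrder.Monic.prod fun I _ => I.monic_genericMinor.pow

theorem degree_genericMonomial (m : GrIndex d n →₀ ℕ) : MonomialOrder.lex.degree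
    (m.prod fun I k => (genericMatrix d n).maximalMinor I.1 ^ k) = leadExp m := by
  rw [Finsupp.prod, MonomialOrder.degree_prod fun I _ => I.monic_genericMinor.pow.ne_zero]
  refine Finset.sum_congr rfl fun I _ => ?_
  rw [MonomialOrder.degree_pow, I.degree_genericMinor]

-- Leading exponents of distinct standard monomials are distinct, so the largest of them cannot
-- cancel.
open MonomialOrder in
theorem eq_zero_of_aeval_genericMinor (hd : 1 ≤ d) {p : MvPolynomial (GrIndex d n) ℂ}
    (hp : ∀ m ∈ p.support, IsStandard m)
    (h : MvPolynomial.aeval (fun I : GrIndex d n => (genericMatrix d n).maximalMinor I.1) p = 0) :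
    p = 0 := by
  by_contra hne
  obtain ⟨m, hm, hmax⟩ := Finset.exists_max_image p.support
    (fun m => MonomialOrder.lex.toSyn (leadExp m)) (MvPolynomial.support_nonempty.2 hne)
  rw [MvPolynomial.aeval_def, MvPolynomial.eval₂_eq] at h
  have hc := congr(MvPolynomial.coeff (leadExp m) $h)
  rw [MvPolynomial.coeff_sum, Finset.sum_eq_single m] at hc
  · have h1 := (monic_genericMonomial m).coeff_degree
    rw [degree_genericMonomial] at h1
    rw [MvPolynomial.algebraMap_eq, MvPolynomial.coeff_C_mul, MvPolynomial.coeff_zero] at hc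
    have h2 : p.coeff m * 1 = 0 := by
      rw [← h1]
      exact hc
    exact MvPolynomial.mem_support_iff.1 hm (by rwa [mul_one] at h2)
  · intro k hk hkm
    rw [MvPolynomial.algebraMap_eq, MvPolynomial.coeff_C_mul]
    have h1 : MonomialOrder.lex.degree
        (k.prod fun I k => (genericMatrix d n).maximalMinor I.1 ^ k) ≺[lex] leadExp m := by
      rw [degree_genericMonomial]
      exact lt_of_le_of_ne (hmax k hk) fun hc =>
        hkm (leadExp_injOn hd (hp k hk) (hp m hm) (MonomialOrder.lex.toSyn.injective hc))
    exact mul_eq_zero_of_right _ (MonomialOrder.lex.coeff_eq_zero_of_lt h1)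
  · exact fun h => absurd hm h

theorem exists_mem_pluckerVectors {A : Matrix (Fin d) (Fin n) ℂ} {I : GrIndex d n}
    (h : A.maximalMinor I.1 ≠ 0) :
    (fun K : GrIndex d n => A.maximalMinor K.1) ∈ pluckerVectors d n := by
  have hli : LinearIndependent ℂ A.row := by
    have := Matrix.linearIndependent_rows_of_det_ne_zero h
    exact LinearIndependent.of_comp (LinearMap.funLeft ℂ ℂ I.1) this
  refine ⟨_, Module.Basis.span hli, ?_⟩
  ext K
  simp only [Module.Basis.span_apply]
  rfl

theorem eq_zero_of_aeval_pluckerVectors (hd : 1 ≤ d) (hdn : d ≤ n)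
    {p : MvPolynomial (GrIndex d n) ℂ}
    (hp : ∀ m ∈ p.support, IsStandard m)
    (h : ∀ x ∈ pluckerVectors d n, MvPolynomial.aeval x p = 0) : p = 0 := by
  refine eq_zero_of_aeval_genericMinor hd hp ?_
  have h0 := (GrIndex.least hdn).monic_genericMinor.ne_zero
  -- A matrix gives a Plücker vector only when some minor is nonzero. Multiplying by one fixed minor
  -- covers the remaining matrices, and that factor cancels in a domain.
  refine (mul_eq_zero.1 (MvPolynomial.funext fun y => ?_)).resolve_right h0
  rw [map_mul, map_zero, mul_eq_zero, or_iff_not_imp_right]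
  intro hy
  let A : Matrix (Fin d) (Fin n) ℂ := Matrix.of fun a j => y (toLex (a, j))
  have hA (K : GrIndex d n) :
      MvPolynomial.eval y ((genericMatrix d n).maximalMinor K.1) = A.maximalMinor K.1 := by
    rw [Matrix.maximalMinor, RingHom.map_det]
    congr 1
    ext a j
    simp [genericMatrix, A]
  rw [hA] at hy
  have := h _ (exists_mem_pluckerVectors hy)
  change MvPolynomial.aeval y _ = 0
  rw [MvPolynomial.comp_aeval_apply, ← this]
  exact congr(MvPolynomial.aeval $(funext hA) p)

end StandardMonomials

/-! ### Specialization of the parameter and the fibres of a family -/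

section Fibres

open Polynomial in
/-- The homomorphism `ℂ[t][x_s] → ℂ[x_s]` that puts `t = c` and rescales each variable `x_s`
by `u s`. -/
noncomputable def specializeHom {σ : Type} (c : ℂ) (u : σ → ℂ) :
    MvPolynomial σ ℂ[X] →+* MvPolynomial σ ℂ :=
  MvPolynomial.eval₂Hom (MvPolynomial.C.comp (Polynomial.evalRingHom c))
    fun s => MvPolynomial.C (u s) * MvPolynomial.X s

variable {σ : Type} (c : ℂ) (u : σ → ℂ)

theorem specializeHom_X (s : σ) :
    specializeHom c u (MvPolynomial.X s) = MvPolynomial.C (u s) * MvPolynomial.X s :=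
  MvPolynomial.eval₂Hom_X' _ _ _

theorem specializeHom_C (r : Polynomial ℂ) :
    specializeHom c u (MvPolynomial.C r) = MvPolynomial.C (r.eval c) :=
  MvPolynomial.eval₂Hom_C _ _ _

theorem specializeHom_one : specializeHom c (1 : σ → ℂ) =
    MvPolynomial.map (Polynomial.evalRingHom c) := by
  refine MvPolynomial.ringHom_ext (fun r => ?_) fun s => ?_
  · rw [specializeHom_C, MvPolynomial.map_C]
    rfl
  · simp [specializeHom_X]

theorem specializeHom_monomial (m : σ →₀ ℕ) (r : Polynomial ℂ) :
    specializeHom c u (MvPolynomial.monomial m r) =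
      MvPolynomial.monomial m (r.eval c * m.prod fun s k => u s ^ k) := by
  rw [specializeHom, MvPolynomial.coe_eval₂Hom, MvPolynomial.eval₂_monomial,
    MvPolynomial.monomial_eq, Finsupp.prod, Finsupp.prod, Finsupp.prod]
  simp only [mul_pow, Finset.prod_mul_distrib, map_mul, map_prod, map_pow, RingHom.comp_apply,
    Polynomial.coe_evalRingHom, mul_assoc]

theorem coeff_specializeHom (m : σ →₀ ℕ) (f : MvPolynomial σ (Polynomial ℂ)) :
    (specializeHom c u f).coeff m = (f.coeff m).eval c * m.prod fun s k => u s ^ k := by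
  classical
  induction f using MvPolynomial.induction_on' with
  | monomial k r =>
    rw [specializeHom_monomial, MvPolynomial.coeff_monomial, MvPolynomial.coeff_monomial]
    split_ifs with h
    · rw [h]
    · simp
  | add p q hp hq =>
    rw [map_add, MvPolynomial.coeff_add, MvPolynomial.coeff_add, hp, hq, Polynomial.eval_add,
      add_mul]

theorem isHomogeneous_specializeHom {f : MvPolynomial σ (Polynomial ℂ)} {i : ℕ}
    (hf : f.IsHomogeneous i) : (specializeHom c u f).IsHomogeneous i := by
  intro m hm
  rw [coeff_specializeHom] at hm
  refine hf fun h => hm ?_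
  rw [h, Polynomial.eval_zero, zero_mul]

theorem specializeHom_surjective (hu : ∀ s, u s ≠ 0) :
    Function.Surjective (specializeHom c u) := by
  intro f
  induction f using MvPolynomial.induction_on with
  | C a => exact ⟨MvPolynomial.C (Polynomial.C a), by rw [specializeHom_C, Polynomial.eval_C]⟩
  | add p q hp hq =>
    obtain ⟨p, rfl⟩ := hp
    obtain ⟨q, rfl⟩ := hq
    exact ⟨p + q, map_add _ _ _⟩
  | mul_X p s hp =>
    obtain ⟨p, rfl⟩ := hp
    refine ⟨p * (MvPolynomial.C (Polynomial.C (u s)⁻¹) * MvPolynomial.X s), ?_⟩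
    rw [map_mul, map_mul, specializeHom_X, specializeHom_C, Polynomial.eval_C,
      ← mul_assoc (MvPolynomial.C _), ← MvPolynomial.C_mul, inv_mul_cancel₀ (hu s),
      MvPolynomial.C_1, one_mul]

theorem exists_eq_mul_of_specializeHom_eq_zero (hu : ∀ s, u s ≠ 0)
    {f : MvPolynomial σ (Polynomial ℂ)} (h : specializeHom c u f = 0) :
    ∃ g, f = MvPolynomial.C (Polynomial.X - Polynomial.C c) * g := by
  refine (MvPolynomial.C_dvd_iff_dvd_coeff _ _).2 fun m => ?_
  rw [Polynomial.dvd_iff_isRoot, Polynomial.IsRoot.def]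
  have h1 := coeff_specializeHom c u m f
  rw [h, MvPolynomial.coeff_zero] at h1
  exact (mul_eq_zero.1 h1.symm).resolve_right
    (Finset.prod_ne_zero_iff.2 fun s _ => pow_ne_zero _ (hu s))

/-- The nonzero scalars `u` allow a change of coordinates to be absorbed into the specialization.
Modulo J, every element of the kernel of the induced map is a multiple of t - c, so
`isPullback_projMap` exhibits Proj of the quotient by K as the fibre. -/
theorem nonempty_familyFibre_iso (J : HomIdeal σ (Polynomial ℂ)) (K : HomIdeal σ ℂ)
    (hu : ∀ s, u s ≠ 0) (h : J.toIdeal.map (specializeHom c u) = K.toIdeal) :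
    Nonempty (familyFibre J c ≅ projSchemeOver K) := by
  have hle : J.toIdeal ≤ K.toIdeal.comap (specializeHom c u) := Ideal.map_le_iff_le_comap.1 h.le
  let f : quotGrading J →+*ᵍ quotGrading K :=
    { Ideal.quotientMap K.toIdeal (specializeHom c u) hle with
      map_mem := by
        rintro i _ ⟨x, hx, rfl⟩
        exact mk_mem_quotGrading K (isHomogeneous_specializeHom c u hx) }
  have hmk (x) : f (Ideal.Quotient.mk J.toIdeal x) =
      Ideal.Quotient.mk K.toIdeal (specializeHom c u x) := rfl
  have hf : Function.Surjective f := by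
    intro y
    obtain ⟨y, rfl⟩ := Ideal.Quotient.mk_surjective y
    obtain ⟨x, rfl⟩ := specializeHom_surjective c u hu y
    exact ⟨Ideal.Quotient.mk _ x, rfl⟩
  have hp := isPullback_projMap (Polynomial.evalRingHom c) f hf
    (fun z => ⟨Polynomial.C z, Polynomial.eval_C⟩)
    (fun r => congrArg (Ideal.Quotient.mk K.toIdeal) (specializeHom_C c u r))
    (Polynomial.X - Polynomial.C c) (by simp) (by
      intro a ha
      obtain ⟨a, rfl⟩ := Ideal.Quotient.mk_surjective a
      rw [hmk, Ideal.Quotient.eq_zero_iff_mem, ← h,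
        Ideal.mem_map_iff_of_surjective _ (specializeHom_surjective c u hu)] at ha
      obtain ⟨j, hj, hja⟩ := ha
      obtain ⟨g, hg⟩ := exists_eq_mul_of_specializeHom_eq_zero c u hu
        (f := a - j) (by rw [map_sub, hja, sub_self])
      refine ⟨Ideal.Quotient.mk _ g, ?_⟩
      rw [show a = j + (a - j) by ring, map_add, Ideal.Quotient.eq_zero_iff_mem.2 hj, zero_add, hg,
        map_mul]
      rfl)
  exact ⟨Over.isoMk hp.isoPullback.symm hp.isoPullback_inv_snd⟩

end Fibres

theorem HomogeneousIdeal.mem_homogeneousCore_iff {A σ : Type} [CommRing A] [SetLike σ A]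
    [AddSubgroupClass σ A] {𝒜 : ℕ → σ} [GradedRing 𝒜] {I : Ideal A} {a : A} :
    a ∈ (I.homogeneousCore 𝒜).toIdeal ↔ ∀ i, (decompose 𝒜 a i : A) ∈ I := by
  classical
  constructor
  · intro ha i
    exact Ideal.toIdeal_homogeneousCore_le 𝒜 I ((I.homogeneousCore 𝒜).isHomogeneous i ha)
  · intro h
    rw [← DirectSum.sum_support_decompose 𝒜 a]
    exact Ideal.sum_mem _ fun i _ =>
      Ideal.mem_homogeneousCore_of_homogeneous_of_mem ⟨i, SetLike.coe_mem _⟩ (h i)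

/-! ### The family of rescaled Grassmannians -/

section Family

variable {d n : ℕ}

/-- The exponent of `t` by which a Plücker coordinate is rescaled. -/
def GrIndex.height (I : GrIndex d n) : ℕ := (d * n) ^ 2 - I.weight ^ 2

theorem GrIndex.height_add (I : GrIndex d n) : I.height + I.weight ^ 2 = (d * n) ^ 2 := by
  refine Nat.sub_add_cancel (Nat.pow_le_pow_left ?_ 2)
  rw [GrIndex.weight]
  calc ∑ k, (I.1 k : ℕ) ≤ ∑ _k : Fin d, n := Finset.sum_le_sum fun k _ => (I.1 k).2.le
    _ = d * n := by simp

open Polynomial in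
/-- The evaluation of a polynomial at the rescaled Plücker vectors `t ^ height I * x I`. -/
noncomputable def familyHom (d n : ℕ) : MvPolynomial (GrIndex d n) ℂ[X] →ₐ[ℂ[X]]
    (pluckerVectors d n → ℂ[X]) :=
  MvPolynomial.aeval fun I x => X ^ I.height * C (x.1 I)

/-- The ideal of the family of rescaled Grassmannians. -/
noncomputable def familyIdeal (d n : ℕ) : HomIdeal (GrIndex d n) (Polynomial ℂ) :=
  Ideal.homogeneousCore _ (RingHom.ker (familyHom d n))

theorem familyHom_X (I : GrIndex d n) (x : pluckerVectors d n) :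
    familyHom d n (MvPolynomial.X I) x = Polynomial.X ^ I.height * Polynomial.C (x.1 I) := by
  rw [familyHom, MvPolynomial.aeval_X]

theorem familyHom_C (r : Polynomial ℂ) (x : pluckerVectors d n) :
    familyHom d n (MvPolynomial.C r) x = r := by
  rw [familyHom, MvPolynomial.aeval_C]
  rfl

theorem familyHom_monomial (m : GrIndex d n →₀ ℕ) (r : Polynomial ℂ) (x : pluckerVectors d n) :
    familyHom d n (MvPolynomial.monomial m r) x =
      r * Polynomial.X ^ (Finsupp.weight GrIndex.height m) *
        Polynomial.C (m.prod fun I k => x.1 I ^ k) := by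
  rw [familyHom, MvPolynomial.aeval_monomial, Finsupp.weight_apply, Finsupp.sum, Finsupp.prod,
    Finsupp.prod, map_prod, ← Finset.prod_pow_eq_pow_sum, mul_assoc, ← Finset.prod_mul_distrib,
    Pi.mul_apply, Finset.prod_apply]
  refine congrArg₂ _ rfl (Finset.prod_congr rfl fun I _ => ?_)
  rw [Pi.pow_apply, mul_pow, ← pow_mul, map_pow, smul_eq_mul, mul_comm I.height]

theorem eval_familyHom (c : ℂ) (f : MvPolynomial (GrIndex d n) (Polynomial ℂ))
    (x : pluckerVectors d n) : (familyHom d n f x).eval c =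
      MvPolynomial.aeval x.1 (specializeHom c (fun I => c ^ I.height) f) := by
  induction f using MvPolynomial.induction_on with
  | C a => simp [familyHom_C, specializeHom_C]
  | add p q hp hq => rw [map_add, Pi.add_apply, Polynomial.eval_add, hp, hq, map_add, map_add]
  | mul_X p I hp =>
    rw [map_mul, Pi.mul_apply, Polynomial.eval_mul, hp, map_mul, map_mul, familyHom_X,
      specializeHom_X]
    simp only [Polynomial.eval_mul, Polynomial.eval_pow, Polynomial.eval_X, Polynomial.eval_C,
      map_mul, MvPolynomial.aeval_X, MvPolynomial.algHom_C, Algebra.algebraMap_self,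
      RingHom.id_apply]

theorem mem_familyIdeal {f : MvPolynomial (GrIndex d n) (Polynomial ℂ)} {i : ℕ}
    (hf : f.IsHomogeneous i) (h : familyHom d n f = 0) : f ∈ (familyIdeal d n).toIdeal :=
  Ideal.mem_homogeneousCore_of_homogeneous_of_mem ⟨i, hf⟩ h

theorem familyHom_eq_zero {f : MvPolynomial (GrIndex d n) (Polynomial ℂ)}
    (hf : f ∈ (familyIdeal d n).toIdeal) : familyHom d n f = 0 :=
  Ideal.toIdeal_homogeneousCore_le _ _ hf

/-- The evaluation takes values in functions to the domain ℂ[t], which have no torsion; the argument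
applies to each homogeneous component. -/
theorem mem_familyIdeal_of_C_mul_mem {r : Polynomial ℂ} (hr : r ≠ 0)
    {f : MvPolynomial (GrIndex d n) (Polynomial ℂ)}
    (h : MvPolynomial.C r * f ∈ (familyIdeal d n).toIdeal) : f ∈ (familyIdeal d n).toIdeal := by
  rw [familyIdeal, HomogeneousIdeal.mem_homogeneousCore_iff] at h ⊢
  intro i
  have h1 := h i
  rw [← MvPolynomial.smul_eq_C_mul, decompose_smul, RingHom.mem_ker] at h1
  have h2 : r • familyHom d n (decompose (MvPolynomial.homogeneousSubmodule _ _) f i) = 0 := by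
    rw [← map_smul]
    exact h1
  exact (smul_eq_zero.1 h2).resolve_left hr

theorem flat_familyIdeal (d n : ℕ) : Flat (projSchemeStr (familyIdeal d n)) := by
  refine flat_projStr fun r a hr ha => ?_
  obtain ⟨f, rfl⟩ := Ideal.Quotient.mk_surjective a
  rw [Ideal.Quotient.eq_zero_iff_mem]
  refine mem_familyIdeal_of_C_mul_mem hr (Ideal.Quotient.eq_zero_iff_mem.1 ?_)
  rw [map_mul]
  exact ha

theorem exists_eq_maximalMinor {x : GrIndex d n → ℂ} (hx : x ∈ pluckerVectors d n) :
    ∃ A : Matrix (Fin d) (Fin n) ℂ, x = fun I => A.maximalMinor I.1 := by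
  obtain ⟨W, b, rfl⟩ := hx
  exact ⟨Matrix.of fun a => (b a : Fin n → ℂ), rfl⟩

/-- The products of two coordinates and a positive power of `t` that become `t ^ N` times
a product of two minors. -/
def lowerProducts (d n N : ℕ) : Set (MvPolynomial (GrIndex d n) (Polynomial ℂ)) :=
  {f | ∃ (K L : GrIndex d n) (e : ℕ), e + 1 + K.height + L.height = N ∧
    f = MvPolynomial.C (Polynomial.X ^ (e + 1)) * (MvPolynomial.X K * MvPolynomial.X L)}

/-- The straightening law multiplied by t^N, N being the height of p_I p_J. Each product p_K p_L has
smaller height, and the difference e + 1 > 0 remains as an explicit power of t. -/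
theorem exists_straightening {I J : GrIndex d n} (h₁ : ¬ I ≤ J) (h₂ : ¬ J ≤ I) :
    ∃ g ∈ Submodule.span (Polynomial ℂ) (lowerProducts d n (I.height + J.height)),
      MvPolynomial.X I * MvPolynomial.X J - g ∈ (familyIdeal d n).toIdeal := by
  wlog hw : I.weight ≤ J.weight generalizing I J
  · obtain ⟨g, hg, hgJ⟩ := this h₂ h₁ (le_of_not_ge hw)
    rw [add_comm] at hg
    rw [mul_comm] at hgJ
    exact ⟨g, hg, hgJ⟩
  set N := I.height + J.height with hN
  have key : ∀ F ∈ Submodule.span ℂ {F : Matrix (Fin d) (Fin n) ℂ → ℂ | ∃ K L : GrIndex d n,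
      I.weight ^ 2 + J.weight ^ 2 < K.weight ^ 2 + L.weight ^ 2 ∧
        F = fun A => A.maximalMinor K.1 * A.maximalMinor L.1},
      ∃ g ∈ Submodule.span (Polynomial ℂ) (lowerProducts d n N),
        ∀ (A : Matrix (Fin d) (Fin n) ℂ) (x : pluckerVectors d n),
          (x.1 = fun I => A.maximalMinor I.1) →
            familyHom d n g x = Polynomial.X ^ N * Polynomial.C (F A) := by
    intro F hF
    induction hF using Submodule.span_induction with
    | mem F hF =>
      obtain ⟨K, L, hKL, rfl⟩ := hF
      obtain ⟨e, he⟩ : ∃ e, e + 1 + K.height + L.height = N := by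
        have h1 := I.height_add
        have h2 := J.height_add
        have h3 := K.height_add
        have h4 := L.height_add
        exact ⟨N - K.height - L.height - 1, by omega⟩
      refine ⟨_, Submodule.subset_span ⟨K, L, e, he, rfl⟩, fun A x hx => ?_⟩
      rw [map_mul, map_mul, Pi.mul_apply, Pi.mul_apply, familyHom_C, familyHom_X, familyHom_X, hx,
        ← he, map_mul]
      ring
    | zero => exact ⟨0, zero_mem _, by simp⟩
    | add F G _ _ hF hG =>
      obtain ⟨f, hf, hfF⟩ := hF
      obtain ⟨g, hg, hgG⟩ := hG
      refine ⟨f + g, add_mem hf hg, fun A x hx => ?_⟩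
      rw [map_add, Pi.add_apply, hfF A x hx, hgG A x hx, Pi.add_apply, map_add, mul_add]
    | smul a F _ hF =>
      obtain ⟨f, hf, hfF⟩ := hF
      refine ⟨Polynomial.C a • f, Submodule.smul_mem _ _ hf, fun A x hx => ?_⟩
      rw [map_smul, Pi.smul_apply, hfF A x hx, Pi.smul_apply, smul_eq_mul, smul_eq_mul, map_mul]
      ring
  obtain ⟨g, hg, hgF⟩ := key _ (Matrix.maximalMinor_mul_mem_span I J h₁ hw)
  refine ⟨g, hg, mem_familyIdeal (i := 2) ?_ ?_⟩
  · refine ((MvPolynomial.isHomogeneous_X _ I).mul (MvPolynomial.isHomogeneous_X _ J)).sub ?_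
    have : Submodule.span (Polynomial ℂ) (lowerProducts d n N) ≤
        MvPolynomial.homogeneousSubmodule _ _ 2 := by
      rw [Submodule.span_le]
      rintro _ ⟨K, L, e, -, rfl⟩
      exact (MvPolynomial.isHomogeneous_C _ _).mul
        ((MvPolynomial.isHomogeneous_X _ K).mul (MvPolynomial.isHomogeneous_X _ L))
    exact this hg
  · funext x
    obtain ⟨A, hA⟩ := exists_eq_maximalMinor x.2
    rw [map_sub, map_mul, Pi.sub_apply, Pi.mul_apply, familyHom_X, familyHom_X, hgF A x hA, hA, hN,
      map_mul, Pi.zero_apply]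
    ring

/-- The span of the standard monomials. -/
noncomputable def standardSpan (d n : ℕ) :
    Submodule (Polynomial ℂ) (MvPolynomial (GrIndex d n) (Polynomial ℂ)) :=
  MvPolynomial.restrictSupport _ {m | IsStandard m}

theorem exists_of_not_isStandard {m : GrIndex d n →₀ ℕ} (h : ¬ IsStandard m) :
    ∃ (I J : GrIndex d n) (k : GrIndex d n →₀ ℕ), ¬ I ≤ J ∧ ¬ J ≤ I ∧
      m = k + (Finsupp.single I 1 + Finsupp.single J 1) := by
  classical
  obtain ⟨I, hI, J, hJ, hIJ, h₁, h₂⟩ : ∃ I ∈ m.support, ∃ J ∈ m.support, I ≠ J ∧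
      ¬ I ≤ J ∧ ¬ J ≤ I := by
    simpa [IsStandard, IsChain, Set.Pairwise] using h
  have : Finsupp.single I 1 + Finsupp.single J 1 ≤ m := by
    intro K
    rw [Finsupp.mem_support_iff] at hI hJ
    simp only [Finsupp.add_apply, Finsupp.single_apply]
    split_ifs with h3 h4 h4
    · exact absurd (h3.trans h4.symm) hIJ
    · subst h3; omega
    · subst h4; omega
    · omega
  obtain ⟨k, rfl⟩ := exists_add_of_le this
  exact ⟨I, J, k, h₁, h₂, add_comm _ _⟩

/-- Replacing an incomparable pair by its straightening strictly lowers the total height, so the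
rewriting terminates. -/
theorem monomial_mem_sup (m : GrIndex d n →₀ ℕ) :
    MvPolynomial.monomial m (1 : Polynomial ℂ) ∈
      standardSpan d n ⊔ (familyIdeal d n).toIdeal.restrictScalars (Polynomial ℂ) := by
  set U := standardSpan d n ⊔ (familyIdeal d n).toIdeal.restrictScalars (Polynomial ℂ) with hU
  induction hN : Finsupp.weight GrIndex.height m using Nat.strong_induction_on generalizing m with
  | _ N ih =>
  by_cases hm : IsStandard m
  · exact Submodule.mem_sup_left ((MvPolynomial.monomial_mem_restrictSupport _).2 (Or.inl hm))
  obtain ⟨I, J, k, h₁, h₂, rfl⟩ := exists_of_not_isStandard hm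
  obtain ⟨g, hg, hgJ⟩ := exists_straightening h₁ h₂
  have hsplit : MvPolynomial.monomial (k + (Finsupp.single I 1 + Finsupp.single J 1))
      (1 : Polynomial ℂ) = MvPolynomial.monomial k 1 * g +
        MvPolynomial.monomial k 1 * (MvPolynomial.X I * MvPolynomial.X J - g) := by
    rw [← mul_add, add_sub_cancel, MvPolynomial.X, MvPolynomial.X, MvPolynomial.monomial_mul,
      MvPolynomial.monomial_mul]
    simp
  rw [hsplit]
  refine add_mem ?_ (Submodule.mem_sup_right (Ideal.mul_mem_left _ _ hgJ))
  clear hgJ hsplit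
  induction hg using Submodule.span_induction with
  | mem g hg =>
    obtain ⟨K, L, e, he, rfl⟩ := hg
    have hlt :
        Finsupp.weight GrIndex.height (k + (Finsupp.single K 1 + Finsupp.single L 1)) < N := by
      rw [← hN]
      simp only [map_add, Finsupp.weight_single, one_smul]
      omega
    have h4 := U.smul_mem (Polynomial.X ^ (e + 1)) (ih _ hlt _ rfl)
    convert h4 using 1
    rw [MvPolynomial.smul_eq_C_mul, MvPolynomial.X, MvPolynomial.X, MvPolynomial.monomial_mul,
      mul_left_comm, MvPolynomial.monomial_mul]
    simp
  | zero => rw [mul_zero]; exact zero_mem _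
  | add f g _ _ hf hg => rw [mul_add]; exact add_mem hf hg
  | smul a f _ hf => rw [mul_smul_comm]; exact U.smul_mem _ hf

theorem standardSpan_sup_familyIdeal :
    standardSpan d n ⊔ (familyIdeal d n).toIdeal.restrictScalars (Polynomial ℂ) = ⊤ := by
  refine eq_top_iff.2 fun f _ => ?_
  induction f using MvPolynomial.induction_on' with
  | monomial m r =>
    have := Submodule.smul_mem _ r (monomial_mem_sup m)
    rwa [MvPolynomial.smul_monomial, smul_eq_mul, mul_one] at this
  | add p q hp hq => exact add_mem (hp trivial) (hq trivial)

theorem mem_standardSpan {f : MvPolynomial (GrIndex d n) (Polynomial ℂ)} :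
    f ∈ standardSpan d n ↔ ∀ m ∈ f.support, IsStandard m := by
  rw [standardSpan, MvPolynomial.mem_restrictSupport_iff]
  rfl

theorem eq_zero_of_mem_standardSpan (hd : 1 ≤ d) (hdn : d ≤ n)
    {s : MvPolynomial (GrIndex d n) (Polynomial ℂ)} (hs : s ∈ standardSpan d n)
    (h : familyHom d n s = 0) : s = 0 := by
  ext1 m
  rw [MvPolynomial.coeff_zero]
  -- At every c ≠ 0 independence over ℂ kills the specialized polynomial, so each coefficient in
  -- ℂ[t] has infinitely many roots.
  refine Polynomial.eq_zero_of_infinite_isRoot _ (Set.Infinite.mono (fun c hc => ?_)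
    (Set.finite_singleton (0 : ℂ)).infinite_compl)
  have hc : c ≠ 0 := hc
  have h0 : specializeHom c (fun I : GrIndex d n => c ^ I.height) s = 0 := by
    refine eq_zero_of_aeval_pluckerVectors hd hdn (fun m hm => mem_standardSpan.1 hs m ?_)
      fun x hx => ?_
    · rw [MvPolynomial.mem_support_iff, coeff_specializeHom] at hm
      rw [MvPolynomial.mem_support_iff]
      intro h1
      rw [h1, Polynomial.eval_zero, zero_mul] at hm
      exact hm rfl
    · rw [← eval_familyHom c s ⟨x, hx⟩, h]
      simp
  have h1 := coeff_specializeHom c (fun I : GrIndex d n => c ^ I.height) m s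
  rw [h0, MvPolynomial.coeff_zero, eq_comm, mul_eq_zero] at h1
  refine h1.resolve_right ?_
  exact Finset.prod_ne_zero_iff.2 fun I _ => pow_ne_zero _ (pow_ne_zero _ hc)

theorem mem_incompIdeal_of_monomial {m : GrIndex d n →₀ ℕ} (h : ¬ IsStandard m) (a : ℂ) :
    MvPolynomial.monomial m a ∈ (incompIdeal d n).toIdeal := by
  obtain ⟨I, J, k, h₁, h₂, rfl⟩ := exists_of_not_isStandard h
  have : MvPolynomial.monomial (k + (Finsupp.single I 1 + Finsupp.single J 1)) a =
      MvPolynomial.monomial k a * (MvPolynomial.X I * MvPolynomial.X J) := by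
    rw [MvPolynomial.X, MvPolynomial.X, MvPolynomial.monomial_mul, MvPolynomial.monomial_mul]
    simp
  rw [this]
  exact Ideal.mul_mem_left _ _ (Ideal.subset_span ⟨I, J, h₁, h₂, rfl⟩)

theorem incompIdeal_le_specializeIdeal :
    (incompIdeal d n).toIdeal ≤ specializeIdeal (familyIdeal d n) 0 := by
  refine Ideal.span_le.2 ?_
  rintro _ ⟨I, J, h₁, h₂, rfl⟩
  obtain ⟨g, hg, hgJ⟩ := exists_straightening h₁ h₂
  have h0 : MvPolynomial.map (Polynomial.evalRingHom (0 : ℂ)) g = 0 := by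
    clear hgJ
    induction hg using Submodule.span_induction with
    | mem g hg =>
      obtain ⟨K, L, e, -, rfl⟩ := hg
      simp
    | zero => exact map_zero _
    | add f g _ _ hf hg => rw [map_add, hf, hg, add_zero]
    | smul a f _ hf => rw [MvPolynomial.smul_eq_C_mul, map_mul, hf, mul_zero]
  have := Ideal.mem_map_of_mem (MvPolynomial.map (Polynomial.evalRingHom (0 : ℂ))) hgJ
  rwa [map_sub, h0, sub_zero, map_mul, MvPolynomial.map_X, MvPolynomial.map_X] at this

theorem exists_eq_add_of_incompIdeal (f : MvPolynomial (GrIndex d n) ℂ) :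
    ∃ s r, (∀ m ∈ s.support, IsStandard m) ∧ r ∈ (incompIdeal d n).toIdeal ∧ f = s + r := by
  classical
  refine ⟨∑ m ∈ f.support with IsStandard m, MvPolynomial.monomial m (f.coeff m),
    ∑ m ∈ f.support with ¬ IsStandard m, MvPolynomial.monomial m (f.coeff m), ?_, ?_, ?_⟩
  · have : ∑ m ∈ f.support with IsStandard m, MvPolynomial.monomial m (f.coeff m) ∈
        MvPolynomial.restrictSupport ℂ {m : GrIndex d n →₀ ℕ | IsStandard m} :=
      Submodule.sum_mem _ fun m hm => (MvPolynomial.monomial_mem_restrictSupport _).2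
        (Or.inl (Finset.mem_filter.1 hm).2)
    exact (MvPolynomial.mem_restrictSupport_iff _).1 this
  · exact Ideal.sum_mem _ fun m hm => mem_incompIdeal_of_monomial (Finset.mem_filter.1 hm).2 _
  · rw [Finset.sum_filter_add_sum_filter_not, ← MvPolynomial.as_sum]

/-- For f in the family ideal, the standard part s of f at t = 0 extends to a standard polynomial
over ℂ[t] in the ideal. Such a polynomial is zero by independence, so s = 0. -/
theorem specializeIdeal_familyIdeal_zero (hd : 1 ≤ d) (hdn : d ≤ n) :
    specializeIdeal (familyIdeal d n) 0 = (incompIdeal d n).toIdeal := by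
  refine le_antisymm (Ideal.map_le_iff_le_comap.2 fun f hf => ?_) incompIdeal_le_specializeIdeal
  have hsurj := MvPolynomial.map_surjective (σ := GrIndex d n) (Polynomial.evalRingHom (0 : ℂ))
    fun a => ⟨Polynomial.C a, Polynomial.eval_C⟩
  rw [Ideal.mem_comap]
  obtain ⟨s, r, hs, hr, hsr⟩ := exists_eq_add_of_incompIdeal
    (MvPolynomial.map (Polynomial.evalRingHom (0 : ℂ)) f)
  obtain ⟨g, hg, hgr⟩ := (Ideal.mem_map_iff_of_surjective _ hsurj).1
    (incompIdeal_le_specializeIdeal hr)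
  set S : MvPolynomial (GrIndex d n) (Polynomial ℂ) := MvPolynomial.map Polynomial.C s with hS
  have hS0 : MvPolynomial.map (Polynomial.evalRingHom (0 : ℂ)) S = s := by
    rw [hS, MvPolynomial.map_map]
    convert MvPolynomial.map_id s
    ext
    simp
  -- Both S and g are lifts from t = 0, so f - S - g = t q. Splitting q into a standard part s' and
  -- a member of the ideal puts S + t s' in the ideal.
  obtain ⟨q, hq⟩ := exists_eq_mul_of_specializeHom_eq_zero (0 : ℂ) (1 : GrIndex d n → ℂ)
    (fun _ => one_ne_zero) (f := f - S - g) (by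
      rw [specializeHom_one, map_sub, map_sub, hS0, hgr, hsr]
      ring)
  obtain ⟨s', hs', j, hj, hsj⟩ := Submodule.mem_sup.1
    ((standardSpan_sup_familyIdeal (d := d) (n := n)).ge (Submodule.mem_top (x := q)))
  have hz : S + MvPolynomial.C (Polynomial.X - Polynomial.C 0) * s' = 0 := by
    refine eq_zero_of_mem_standardSpan hd hdn (add_mem (mem_standardSpan.2 fun m hm => hs m ?_) ?_)
      (familyHom_eq_zero ?_)
    · exact MvPolynomial.support_map_subset _ _ hm
    · rw [← MvPolynomial.smul_eq_C_mul]
      exact Submodule.smul_mem _ _ hs'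
    · have : S + MvPolynomial.C (Polynomial.X - Polynomial.C 0) * s' =
          f - g - MvPolynomial.C (Polynomial.X - Polynomial.C 0) * j := by
        rw [← hsj] at hq
        linear_combination -hq
      rw [this]
      exact sub_mem (sub_mem hf hg) (Ideal.mul_mem_left _ _ hj)
  have hs0 : s = 0 := by
    have := congrArg (MvPolynomial.map (Polynomial.evalRingHom (0 : ℂ))) hz
    simpa [hS0] using this
  rw [hsr, hs0, zero_add]
  exact hr

theorem map_familyIdeal {c : ℂ} (hc : c ≠ 0) :
    (familyIdeal d n).toIdeal.map (specializeHom c fun I : GrIndex d n => c ^ I.height) =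
      (pluckerIdeal d n).toIdeal := by
  refine le_antisymm (Ideal.map_le_iff_le_comap.2 ?_) ?_
  · intro f hf
    rw [Ideal.mem_comap]
    have hfi : ∀ i, specializeHom c (fun I : GrIndex d n => c ^ I.height)
        (MvPolynomial.homogeneousComponent i f) ∈ (pluckerIdeal d n).toIdeal := by
      intro i
      refine Ideal.mem_homogeneousCore_of_homogeneous_of_mem ⟨i, isHomogeneous_specializeHom _ _
        (MvPolynomial.homogeneousComponent_isHomogeneous i f)⟩ fun x hx => ?_
      rw [← eval_familyHom c _ ⟨x, hx⟩, familyHom_eq_zero]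
      · simp
      · have := (familyIdeal d n).isHomogeneous i hf
        exact (MvPolynomial.decomposition.decompose'_apply f i) ▸ this
    rw [← MvPolynomial.sum_homogeneousComponent f, map_sum]
    exact Ideal.sum_mem _ fun i _ => hfi i
  · refine Ideal.span_le.2 ?_
    rintro _ ⟨⟨g, i, hgi⟩, hg, rfl⟩
    have hgi : g.IsHomogeneous i := hgi
    -- Homogenization in t: N is the largest height of a monomial of g, and each monomial is padded
    -- by a power of t so that G evaluates to t^N g(x) on the rescaled vectors and to c^N g at t =
    -- c.
    set N := g.support.sup (Finsupp.weight GrIndex.height) with hN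
    set G : MvPolynomial (GrIndex d n) (Polynomial ℂ) := ∑ m ∈ g.support, MvPolynomial.monomial m
      (Polynomial.C (g.coeff m) * Polynomial.X ^ (N - Finsupp.weight GrIndex.height m)) with hG
    have hle : ∀ m ∈ g.support, N - Finsupp.weight GrIndex.height m +
        Finsupp.weight GrIndex.height m = N := fun m hm =>
      Nat.sub_add_cancel (Finset.le_sup (f := Finsupp.weight GrIndex.height) hm)
    have hGJ : G ∈ (familyIdeal d n).toIdeal := by
      refine mem_familyIdeal (i := i) ?_ ?_
      · refine MvPolynomial.IsHomogeneous.sum _ _ _ fun m hm => ?_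
        exact MvPolynomial.isHomogeneous_monomial _ (by
          rw [Finsupp.degree_eq_weight_one]; exact hgi (MvPolynomial.mem_support_iff.1 hm))
      · funext x
        have hgx : MvPolynomial.aeval x.1 g = 0 := hg x.1 x.2
        rw [hG, map_sum, Finset.sum_apply, Pi.zero_apply]
        rw [MvPolynomial.aeval_def, MvPolynomial.eval₂_eq'] at hgx
        have : (Polynomial.X : Polynomial ℂ) ^ N * Polynomial.C (∑ m ∈ g.support,
          algebraMap ℂ ℂ (g.coeff m) * ∏ I, x.1 I ^ m I) = 0 := by rw [hgx, map_zero, mul_zero]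
        rw [← this, map_sum, Finset.mul_sum]
        refine Finset.sum_congr rfl fun m hm => ?_
        rw [familyHom_monomial, mul_assoc (Polynomial.C _), ← pow_add, hle m hm,
          Finsupp.prod_fintype _ _ (by simp), map_mul]
        simp only [Algebra.algebraMap_self, RingHom.id_apply]
        ring
    have hsp : specializeHom c (fun I : GrIndex d n => c ^ I.height) G =
        MvPolynomial.C (c ^ N) * g := by
      rw [hG, map_sum]
      conv_rhs => rw [g.as_sum, Finset.mul_sum]
      refine Finset.sum_congr rfl fun m hm => ?_
      have hprod :
          (m.prod fun I k => (c ^ I.height) ^ k) = c ^ Finsupp.weight GrIndex.height m := by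
        rw [Finsupp.weight_apply, Finsupp.sum, Finsupp.prod, ← Finset.prod_pow_eq_pow_sum]
        refine Finset.prod_congr rfl fun I _ => ?_
        rw [← pow_mul, smul_eq_mul, mul_comm]
      rw [specializeHom_monomial, hprod, MvPolynomial.C_mul_monomial, Polynomial.eval_mul,
        Polynomial.eval_C, Polynomial.eval_pow, Polynomial.eval_X, mul_assoc, ← pow_add, hle m hm,
        mul_comm]
    have h1 : g = MvPolynomial.C (c ^ N)⁻¹ * (MvPolynomial.C (c ^ N) * g) := by
      rw [← mul_assoc, ← MvPolynomial.C_mul, inv_mul_cancel₀ (pow_ne_zero _ hc), MvPolynomial.C_1,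
        one_mul]
    show g ∈ _
    rw [h1, ← hsp]
    exact Ideal.mul_mem_left _ _ (Ideal.mem_map_of_mem _ hGJ)

theorem specializeIdeal_familyIdeal_one :
    specializeIdeal (familyIdeal d n) 1 = (pluckerIdeal d n).toIdeal := by
  rw [specializeIdeal, ← specializeHom_one, ← map_familyIdeal (c := 1) one_ne_zero]
  simp only [one_pow]
  rfl

end Family

/-- An irreducible set covered by finitely many closed sets lies in one of them; the absence of
inclusions among the Z k makes each one maximal. -/
theorem range_eq_irreducibleComponents {X κ : Type*} [TopologicalSpace X] [Finite κ]
    {Z : κ → Set X} (hc : ∀ k, IsClosed (Z k)) (hi : ∀ k, IsIrreducible (Z k))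
    (hcover : ∀ x, ∃ k, x ∈ Z k) (hle : ∀ k l, Z k ⊆ Z l → k = l) :
    Set.range Z = irreducibleComponents X := by
  have key : ∀ s : Set X, IsIrreducible s → ∃ k, s ⊆ Z k := by
    intro s hs
    obtain ⟨z, hz, hsz⟩ := isIrreducible_iff_sUnion_isClosed.1 hs
      (Set.finite_range Z).toFinset (by simpa using hc) fun x _ => by
        obtain ⟨k, hk⟩ := hcover x
        exact ⟨Z k, by simp, hk⟩
    obtain ⟨k, rfl⟩ := (Set.finite_range Z).mem_toFinset.1 hz
    exact ⟨k, hsz⟩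
  refine Set.Subset.antisymm ?_ fun s hs => ?_
  · rintro _ ⟨k, rfl⟩
    refine ⟨hi k, fun t ht hkt => ?_⟩
    obtain ⟨l, hl⟩ := key t ht
    obtain rfl := hle k l (hkt.trans hl)
    exact hl
  · obtain ⟨k, hk⟩ := key s hs.1
    exact ⟨k, (hs.2 (hi k) hk).antisymm hk⟩

/-! ### Coordinate subspaces as embedded projective spaces -/

section CoordinateSubspace

variable {σ : Type} {N : ℕ} {T : Set σ} (e : T ≃ Fin (N + 1))

open Classical in
/-- The restriction of polynomials to a coordinate subspace. -/
noncomputable def coordRestrict : MvPolynomial σ ℂ →ₐ[ℂ] MvPolynomial (Fin (N + 1)) ℂ :=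
  MvPolynomial.aeval fun s => if h : s ∈ T then MvPolynomial.X (e ⟨s, h⟩) else 0

theorem coordRestrict_X_of_mem {s : σ} (h : s ∈ T) :
    coordRestrict e (MvPolynomial.X s) = MvPolynomial.X (e ⟨s, h⟩) := by
  rw [coordRestrict, MvPolynomial.aeval_X, dif_pos h]

theorem coordRestrict_X_of_notMem {s : σ} (h : s ∉ T) :
    coordRestrict e (MvPolynomial.X s) = 0 := by
  rw [coordRestrict, MvPolynomial.aeval_X, dif_neg h]

theorem coordRestrict_rename (f : MvPolynomial (Fin (N + 1)) ℂ) :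
    coordRestrict e (MvPolynomial.rename (fun j => (e.symm j : σ)) f) = f := by
  induction f using MvPolynomial.induction_on with
  | C a => simp
  | add p q hp hq => rw [map_add, map_add, hp, hq]
  | mul_X p j hp =>
    rw [map_mul, map_mul, hp, MvPolynomial.rename_X, coordRestrict_X_of_mem e (e.symm j).2]
    simp

theorem ker_coordRestrict : RingHom.ker (coordRestrict e) =
    Ideal.span {f | ∃ s, s ∉ T ∧ f = MvPolynomial.X s} := by
  refine le_antisymm (fun f hf => ?_) (Ideal.span_le.2 ?_)
  · have key : ((Ideal.Quotient.mkₐ ℂ (Ideal.span {f : MvPolynomial σ ℂ |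
        ∃ s, s ∉ T ∧ f = MvPolynomial.X s})).comp
          (MvPolynomial.rename fun j => (e.symm j : σ))).comp (coordRestrict e) =
        Ideal.Quotient.mkₐ ℂ _ := by
      refine MvPolynomial.algHom_ext fun s => ?_
      rw [AlgHom.comp_apply]
      by_cases h : s ∈ T
      · rw [coordRestrict_X_of_mem e h, AlgHom.comp_apply, MvPolynomial.rename_X,
          Equiv.symm_apply_apply]
      · rw [coordRestrict_X_of_notMem e h, map_zero, eq_comm]
        exact Ideal.Quotient.eq_zero_iff_mem.2 (Ideal.subset_span ⟨s, h, rfl⟩)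
    refine Ideal.Quotient.eq_zero_iff_mem.1 ?_
    have := DFunLike.congr_fun key f
    rw [AlgHom.comp_apply, RingHom.mem_ker.1 hf, map_zero] at this
    exact this.symm
  · rintro _ ⟨s, hs, rfl⟩
    exact coordRestrict_X_of_notMem e hs

theorem isHomogeneous_coordRestrict {f : MvPolynomial σ ℂ} {i : ℕ} (hf : f.IsHomogeneous i) :
    (coordRestrict e f).IsHomogeneous i := by
  have := hf.aeval (n := 1) (fun s => coordRestrict e (MvPolynomial.X s)) fun s => by
    by_cases h : s ∈ T
    · rw [coordRestrict_X_of_mem e h]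
      exact MvPolynomial.isHomogeneous_X _ _
    · rw [coordRestrict_X_of_notMem e h]
      exact MvPolynomial.isHomogeneous_zero _ _ _
  rw [one_mul] at this
  exact (DFunLike.congr_fun (MvPolynomial.aeval_unique (coordRestrict e)) f) ▸ this

variable (K : HomIdeal σ ℂ) (hK : K.toIdeal ≤ RingHom.ker (coordRestrict e))

/-- The homomorphism of graded rings that defines the embedding of a coordinate subspace. -/
noncomputable def coordQuotHom :
    quotGrading K →+*ᵍ MvPolynomial.homogeneousSubmodule (Fin (N + 1)) ℂ :=
  { Ideal.Quotient.lift K.toIdeal (coordRestrict e).toRingHom fun _ ha => hK ha with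
    map_mem := by
      rintro i _ ⟨x, hx, rfl⟩
      exact isHomogeneous_coordRestrict e hx }

theorem coordQuotHom_surjective : Function.Surjective (coordQuotHom e K hK) := fun f =>
  ⟨Ideal.Quotient.mk _ (MvPolynomial.rename (fun j => (e.symm j : σ)) f),
    coordRestrict_rename e f⟩

/-- The embedding of a coordinate subspace. -/
noncomputable def coordEmbedding : cProjSpaceOver N ⟶ projSchemeOver K :=
  Over.homMk (Proj.map (coordQuotHom e K hK)
    ((coordQuotHom e K hK).irrelevant_le_map (coordQuotHom_surjective e K hK))) (by
    have h := map_comp_projStr (RingHom.id ℂ) (coordQuotHom e K hK)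
      (coordQuotHom_surjective e K hK) fun r => (coordRestrict e).commutes r
    refine h.trans ?_
    rw [CommRingCat.ofHom_id, Spec.map_id]
    exact Category.comp_id _)

theorem isClosedImmersion_coordEmbedding : IsClosedImmersion (coordEmbedding e K hK).left :=
  isClosedImmersion_projMap (coordQuotHom e K hK) (coordQuotHom_surjective e K hK)

theorem range_coordEmbedding : Set.range (coordEmbedding e K hK).left =
    projZeroLocus K {f | ∃ s, s ∉ T ∧ f = MvPolynomial.X s} := by
  refine (range_projMap (coordQuotHom e K hK) (coordQuotHom_surjective e K hK)).trans ?_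
  refine Set.Subset.antisymm (ProjectiveSpectrum.zeroLocus_anti_mono _ ?_) fun p hp => ?_
  · rintro _ ⟨_, ⟨s, hs, rfl⟩, rfl⟩
    exact coordRestrict_X_of_notMem e hs
  · rw [projZeroLocus, ProjectiveSpectrum.mem_zeroLocus] at hp
    rw [ProjectiveSpectrum.mem_zeroLocus]
    intro a ha
    obtain ⟨f, rfl⟩ := Ideal.Quotient.mk_surjective a
    have hf : f ∈ RingHom.ker (coordRestrict e) := ha
    have hle : Ideal.span {f | ∃ s, s ∉ T ∧ f = MvPolynomial.X s} ≤
        p.asHomogeneousIdeal.toIdeal.comap (Ideal.Quotient.mk K.toIdeal) :=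
      Ideal.span_le.2 fun g hg => hp ⟨g, hg, rfl⟩
    rw [ker_coordRestrict] at hf
    exact hle hf

theorem isIrreducible_range_coordEmbedding :
    IsIrreducible (Set.range (coordEmbedding e K hK).left) := by
  have h := isIrreducible_univ_proj (𝒜 := MvPolynomial.homogeneousSubmodule (Fin (N + 1)) ℂ)
    (MvPolynomial.isHomogeneous_X ℂ (0 : Fin (N + 1))) one_pos (MvPolynomial.X_ne_zero _)
  rw [← Set.image_univ]
  exact h.image _ (coordEmbedding e K hK).left.continuous.continuousOn

theorem range_coordEmbedding_subset {U : Set σ}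
    (h : Set.range (coordEmbedding e K hK).left ⊆
      projZeroLocus K {f | ∃ s, s ∉ U ∧ f = MvPolynomial.X s}) : T ⊆ U := by
  intro s hs
  by_contra hU
  -- At the generic point no coordinate vanishes, so it detects a variable indexed by T but not by
  -- U.
  let η : ProjectiveSpectrum (MvPolynomial.homogeneousSubmodule (Fin (N + 1)) ℂ) :=
    ⟨⊥, Ideal.isPrime_bot, fun hle => MvPolynomial.X_ne_zero (R := ℂ) (0 : Fin (N + 1))
      (hle (HomogeneousIdeal.mem_irrelevant_of_mem _ one_pos (MvPolynomial.isHomogeneous_X ℂ _)))⟩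
  have h1 : coordRestrict e (MvPolynomial.X s) ∈ (⊥ : Ideal (MvPolynomial (Fin (N + 1)) ℂ)) :=
    h ⟨η, rfl⟩ ⟨_, ⟨s, hU, rfl⟩, rfl⟩
  rw [coordRestrict_X_of_mem e hs] at h1
  exact MvPolynomial.X_ne_zero _ h1

end CoordinateSubspace

/-! ### The special fibre as a union over maximal chains -/

section SpecialFibre

variable {d n : ℕ}

theorem incompIdeal_le_ker_coordRestrict {N : ℕ} (C : Flag (GrIndex d n))
    (e : (C : Set (GrIndex d n)) ≃ Fin (N + 1)) :
    (incompIdeal d n).toIdeal ≤ RingHom.ker (coordRestrict e) := by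
  refine Ideal.span_le.2 ?_
  rintro _ ⟨I, J, h₁, h₂, rfl⟩
  change coordRestrict e _ = 0
  rw [map_mul]
  by_cases hI : I ∈ (C : Set (GrIndex d n))
  · have hJ : J ∉ (C : Set (GrIndex d n)) := fun hJ => (C.le_or_le hI hJ).elim h₁ h₂
    rw [coordRestrict_X_of_notMem e hJ, mul_zero]
  · rw [coordRestrict_X_of_notMem e hI, zero_mul]

/-- If f had a standard monomial, its support would extend to a maximal chain C. But f lies in the
monomial ideal generated by the variables off C, so each of its monomials involves such a variable.
-/
theorem mem_incompIdeal_of_forall_flag (h : d ≤ n) {f : MvPolynomial (GrIndex d n) ℂ}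
    (hf : ∀ C, coordRestrict (GrIndex.flagEquiv h C) f = 0) : f ∈ (incompIdeal d n).toIdeal := by
  rw [f.as_sum]
  refine Ideal.sum_mem _ fun m hm => mem_incompIdeal_of_monomial (fun hs => ?_) _
  obtain ⟨C, hC⟩ := hs.exists_subset_flag
  have h1 : f ∈ Ideal.span {f | ∃ s, s ∉ (C : Set (GrIndex d n)) ∧ f = MvPolynomial.X s} := by
    rw [← ker_coordRestrict (GrIndex.flagEquiv h C)]
    exact hf C
  have h2 : {f : MvPolynomial (GrIndex d n) ℂ | ∃ s, s ∉ (C : Set (GrIndex d n)) ∧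
      f = MvPolynomial.X s} = MvPolynomial.X '' (C : Set (GrIndex d n))ᶜ := by
    ext g
    exact exists_congr fun s => and_congr_right fun _ => eq_comm
  rw [h2, MvPolynomial.mem_ideal_span_X_image] at h1
  obtain ⟨I, hI, hmI⟩ := h1 m hm
  exact hI (hC (Finsupp.mem_support_iff.2 hmI))

theorem isReduced_projScheme_incompIdeal (h : d ≤ n) :
    AlgebraicGeometry.IsReduced (projScheme (incompIdeal d n)) := by
  have : _root_.IsReduced (MvPolynomial (GrIndex d n) ℂ ⧸ (incompIdeal d n).toIdeal) := by
    refine ⟨fun a => ?_⟩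
    rintro ⟨k, hk⟩
    obtain ⟨f, rfl⟩ := Ideal.Quotient.mk_surjective a
    rw [← map_pow, Ideal.Quotient.eq_zero_iff_mem] at hk
    refine Ideal.Quotient.eq_zero_iff_mem.2 (mem_incompIdeal_of_forall_flag h fun C => ?_)
    have := incompIdeal_le_ker_coordRestrict C (GrIndex.flagEquiv h C) hk
    rw [RingHom.mem_ker, map_pow] at this
    exact eq_zero_of_pow_eq_zero this
  exact isReduced_proj

/-- At any point the nonvanishing coordinates form a chain, since a prime containing p_I p_J
contains a factor; that chain extends to a maximal one. -/
theorem exists_flag_mem_projZeroLocus (p : projScheme (incompIdeal d n)) :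
    ∃ C : Flag (GrIndex d n), p ∈ projZeroLocus (incompIdeal d n)
      {f | ∃ I, I ∉ (C : Set (GrIndex d n)) ∧ f = MvPolynomial.X I} := by
  let q : ProjectiveSpectrum (quotGrading (incompIdeal d n)) := p
  have hchain : IsChain (· ≤ ·) {I : GrIndex d n | Ideal.Quotient.mk (incompIdeal d n).toIdeal
      (MvPolynomial.X I) ∉ q.asHomogeneousIdeal.toIdeal} := by
    intro I hI J hJ _
    by_contra hIJ
    rw [not_or] at hIJ
    have : Ideal.Quotient.mk (incompIdeal d n).toIdeal (MvPolynomial.X I * MvPolynomial.X J) = 0 :=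
      Ideal.Quotient.eq_zero_iff_mem.2 (Ideal.subset_span ⟨I, J, hIJ.1, hIJ.2, rfl⟩)
    have h2 : Ideal.Quotient.mk (incompIdeal d n).toIdeal (MvPolynomial.X I) *
        Ideal.Quotient.mk (incompIdeal d n).toIdeal (MvPolynomial.X J) ∈
          q.asHomogeneousIdeal.toIdeal := by
      rw [← map_mul, this]
      exact Ideal.zero_mem _
    exact (q.isPrime.mem_or_mem h2).elim hI hJ
  obtain ⟨C, hC⟩ := hchain.exists_subset_flag
  refine ⟨C, ?_⟩
  rintro _ ⟨_, ⟨I, hI, rfl⟩, rfl⟩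
  by_contra h
  exact hI (hC h)

end SpecialFibre

theorem mainTheorem1 (d n : ℕ) (hd : 1 ≤ d) (hdn : d ≤ n) :
    ∃ J : HomIdeal (GrIndex d n) (Polynomial ℂ),
      -- the family over the affine line is flat
      Flat (projSchemeStr J) ∧
      -- it degenerates `Gr_{d,n}`: this is the member at `t = 1`, and every fibre over `t ≠ 0`
      -- is isomorphic to it
      specializeIdeal J 1 = (pluckerIdeal d n).toIdeal ∧
      (∀ c : ℂ, c ≠ 0 → Nonempty (familyFibre J c ≅ grassmannianOver d n)) ∧
      -- the ideal of the special fibre is generated by the monomials `p_I p_J`, `I`, `J`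
      -- non-comparable
      specializeIdeal J 0 = (incompIdeal d n).toIdeal ∧
      Nonempty (familyFibre J 0 ≅ projSchemeOver (incompIdeal d n)) ∧
      -- the special fibre is the reduced union of projective spaces indexed by maximal chains
      IsReduced (projScheme (incompIdeal d n)) ∧
      ∃ ι : Flag (GrIndex d n) →
          (cProjSpaceOver (d * (n - d)) ⟶ projSchemeOver (incompIdeal d n)),
        (∀ C, IsClosedImmersion (ι C).left) ∧
        (∀ C, Set.range (ι C).left =
          projZeroLocus (incompIdeal d n) {f | ∃ I : GrIndex d n, I ∉ C ∧ f = MvPolynomial.X I}) ∧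
        Function.Injective (fun C => Set.range (ι C).left) ∧
        Set.range (fun C => Set.range (ι C).left) =
          irreducibleComponents (projScheme (incompIdeal d n)) := by
  have hle : ∀ C, (incompIdeal d n).toIdeal ≤
      RingHom.ker (coordRestrict (GrIndex.flagEquiv hdn C)) := fun C =>
    incompIdeal_le_ker_coordRestrict C _
  have hsub : ∀ C C' : Flag (GrIndex d n),
      Set.range (coordEmbedding (GrIndex.flagEquiv hdn C) (incompIdeal d n) (hle C)).left ⊆
        Set.range (coordEmbedding (GrIndex.flagEquiv hdn C') (incompIdeal d n) (hle C')).left →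
      C = C' := by
    intro C C' h
    rw [range_coordEmbedding _ _ (hle C')] at h
    exact Flag.ext (C.max_chain' C'.chain_le (range_coordEmbedding_subset _ _ _ h))
  refine ⟨familyIdeal d n, flat_familyIdeal d n, specializeIdeal_familyIdeal_one,
    fun c hc => nonempty_familyFibre_iso c _ _ _ (fun I => pow_ne_zero _ hc) (map_familyIdeal hc),
    specializeIdeal_familyIdeal_zero hd hdn,
    nonempty_familyFibre_iso 0 1 _ _ (fun _ => one_ne_zero) ?_,
    isReduced_projScheme_incompIdeal hdn,
    fun C => coordEmbedding (GrIndex.flagEquiv hdn C) (incompIdeal d n) (hle C),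
    fun C => isClosedImmersion_coordEmbedding _ _ _, fun C => range_coordEmbedding _ _ _,
    fun C C' h => hsub C C' (Eq.le h), ?_⟩
  · rw [specializeHom_one]
    exact specializeIdeal_familyIdeal_zero hd hdn
  · refine range_eq_irreducibleComponents (fun C => ?_)
      (fun C => isIrreducible_range_coordEmbedding _ _ _) (fun p => ?_) hsub
    · exact (isClosedImmersion_coordEmbedding _ _ (hle C)).isClosedEmbedding.isClosed_range
    · obtain ⟨C, hC⟩ := exists_flag_mem_projZeroLocus p
      exact ⟨C, (range_coordEmbedding _ _ (hle C)).ge hC⟩
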